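/- Let $T>0$, $d,m\in\mathbb N$, $\alpha>\frac13$, and let $(\zeta,\boldsymbol\zeta^2)$ be a geometric $\alpha$-Hölder rough path on $[0,T]$: writing $\delta g_{st}=g_t-g_s$, the path $\zeta:[0,T]\to\mathbb R^d$ satisfies $\zeta_0=0$ and $|\delta\zeta_{st}|\lesssim|t-s|^{\alpha}$, and $\boldsymbol\zeta^2_{st}\in\mathbb R^{d,d}$, $0\le s\le t\le T$, satisfies $|\boldsymbol\zeta^2_{st}|\lesssim|t-s|^{2\alpha}$ and, for $s\le u\le t$, $$\boldsymbol\zeta^{2;ij}_{st}-\boldsymbol\zeta^{2;ij}_{su}-\boldsymbol\zeta^{2;ij}_{ut}=\delta\zeta^i_{su}\,\delta\zeta^j_{ut},\qquad \boldsymbol\zeta^{2;ij}_{st}+\boldsymbol\zeta^{2;ji}_{st}=\delta\zeta^i_{st}\,\delta\zeta^j_{st}.$$ For $p,k\in\mathbb N$ let $C_b^{p,k}$ be the space of functions on $[0,T]\times\mathbb R^m$ whose time derivatives up to order $p$ and space derivatives up to order $k$ exist and are continuous and bounded on $[0,T]\times\mathbb R^m$. Let $b\in C_b^{0,1}([0,T]\times\mathbb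 R^m;\mathbb R^m)$, $\sigma\in C_b^{1,2}([0,T]\times\mathbb R^m;\mathbb R^{m,d})$ and $y\in\mathbb R^m$. For $\kappa>0$ and a finite-dimensional normed space $V$, a controlled path in $\mathcal Q^\kappa_\zeta([0,T];V)$ is a couple $(z,z^\zeta)$ of $\kappa$-Hölder paths on $[0,T]$, with values in $V$ and $\mathcal L(\mathbb R^d,V)$ respectively, such that $\rho^z_{st}=\delta z_{st}-z^\zeta_s\,\delta\zeta_{st}$ satisfies $|\rho^z_{st}|\lesssim|t-s|^{2\kappa}$. For $\kappa>\frac13$ and $(\mu,\mu^\zeta)\in\mathcal Q^\kappa_\zeta([0,T];\mathbb R^{m,d})$ the rough integral is $$\int_s^t\mu_u\,d\zeta_u=\mu_s^{i}\,\delta\zeta^{i}_{st}+\mu^{\zeta;ij}_s\,\boldsymbol\zeta^{2;ji}_{st}+\Lambda_{st},$$ where repeated indices are summed and $\Lambda$ is the unique two-index map with $|\Lambda_{st}|\lesssim|t-s|^{3\kappa}$ and $\Lambda_{st}-\Lambda_{su}-\Lambda_{ut}=\rho^{\mu;i}_{su}\,\delta\zeta^i_{ut}+\delta\mu^{\zeta;ij}_{su}\,\boldsymbol\zeta^{2;ji}_{ut}$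 for $0\le s\le u\le t\le T$. A solution in $\mathcal Q^\kappa_\zeta$ of $$dx_s=b(s,x_s)\,ds+\sigma(s,x_s)\,d\zeta_s,\qquad x_0=y,$$ is a couple $(x,x^\zeta)\in\mathcal Q^\kappa_\zeta([0,T];\mathbb R^m)$ with $x_0=y$, $x^\zeta_s=\sigma(s,x_s)$, and $$\delta x_{st}=\int_s^tb(u,x_u)\,du+\int_s^t\sigma(u,x_u)\,d\zeta_u\qquad(0\le s\le t\le T),$$ where $\mu_s=\sigma(s,x_s)$ is regarded as a controlled path with $\mu^\zeta_s=\nabla_x\sigma(s,x_s)\,x^\zeta_s$. **Proposition.** For every $\kappa\in(\frac13,\alpha)$ with $\kappa\le\frac12$ there exists a solution in $\mathcal Q^\kappa_\zeta([0,T];\mathbb R^m)$, which moreover can be chosen $\min(\alpha,1)$-Hölder continuous on $[0,T]$. If in addition $\sigma\in C_b^{1,3}([0,T]\times\mathbb R^m;\mathbb R^{m,d})$, the solution in $\mathcal Q^\kappa_\zeta([0,T];\mathbb R^m)$ is unique. -/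

import Mathlib

open Set

namespace RoughDE

/-- The Euclidean space `ℝⁿ`. -/
abbrev Euc (n : ℕ) : Type := EuclideanSpace ℝ (Fin n)

/-- The increment `(δg)_{st} = g_t - g_s` of a path. -/
def incr {V : Type*} [AddCommGroup V] (g : ℝ → V) (s t : ℝ) : V := g t - g s

/-- The operator `(δh)_{sut} = h_{st} - h_{su} - h_{ut}` on two-index maps. -/
def delta {V : Type*} [AddCommGroup V] (h : ℝ → ℝ → V) (s u t : ℝ) : V :=
  h s t - h s u - h u t

/-- `f ∈ C₂^μ([0,T]; V)`: the two-index map `f` satisfies `|f_{st}| ≤ C |t-s|^μ` for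
`0 ≤ s ≤ t ≤ T`. For `μ > 0` this contains the condition `f_{tt} = 0`. -/
def Holder₂ {V : Type*} [NormedAddCommGroup V] (T μ : ℝ) (f : ℝ → ℝ → V) : Prop :=
  ∃ C : ℝ, ∀ s t : ℝ, 0 ≤ s → s ≤ t → t ≤ T → ‖f s t‖ ≤ C * (t - s) ^ μ

/-- `g ∈ C₁^μ([0,T]; V)`: the path `g` is `μ`-Hölder continuous on `[0,T]`. -/
def Holder₁ {V : Type*} [NormedAddCommGroup V] (T μ : ℝ) (g : ℝ → V) : Prop :=
  Holder₂ T μ (incr g)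

/-- `(ζ, ζ²)` is a geometric `α`-Hölder rough path over `[0,T]` started at `0`;
`ζ2 s t i j` is the component `ζ^{2;ij}_{st}` of the Lévy area. -/
structure IsGeometricRoughPath {d : ℕ} (T α : ℝ) (ζ : ℝ → Euc d)
    (ζ2 : ℝ → ℝ → Fin d → Fin d → ℝ) : Prop where
  zero : ζ 0 = 0
  holder_path : Holder₁ T α ζ
  holder_area : Holder₂ T (2 * α) ζ2
  chen : ∀ s u t : ℝ, 0 ≤ s → s ≤ u → u ≤ t → t ≤ T → ∀ i j : Fin d,
    delta ζ2 s u t i j = incr ζ s u i * incr ζ u t j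
  shuffle : ∀ s t : ℝ, 0 ≤ s → s ≤ t → t ≤ T → ∀ i j : Fin d,
    ζ2 s t i j + ζ2 s t j i = incr ζ s t i * incr ζ s t j

/-- The remainder `ρ_{st} = δz_{st} - z^ζ_s δζ_{st}`. -/
def remainder {d : ℕ} {V : Type*} [NormedAddCommGroup V] [NormedSpace ℝ V]
    (ζ : ℝ → Euc d) (z : ℝ → V) (z' : ℝ → Euc d →L[ℝ] V) (s t : ℝ) : V :=
  incr z s t - z' s (incr ζ s t)

/-- The couple `(z, z^ζ)` (with `z' = z^ζ`) belongs to the space `Q_ζ^κ([0,T]; V)` of weakly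
controlled paths: `z, z^ζ ∈ C₁^κ` and `ρ ∈ C₂^{2κ}`. -/
structure IsWeaklyControlled {d : ℕ} {V : Type*} [NormedAddCommGroup V] [NormedSpace ℝ V]
    (T κ : ℝ) (ζ : ℝ → Euc d) (z : ℝ → V) (z' : ℝ → Euc d →L[ℝ] V) : Prop where
  holder : Holder₁ T κ z
  holder_deriv : Holder₁ T κ z'
  holder_remainder : Holder₂ T (2 * κ) (remainder ζ z z')

/-- The contraction `∑ A^{i j} M^{j i}`, where `A^{i j} = A e_j e_i`. For `A = μ^ζ_s`, the first
argument of `A` is the direction of the derivative with respect to `ζ`. -/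
noncomputable def areaTerm {d : ℕ} {V : Type*} [NormedAddCommGroup V] [NormedSpace ℝ V]
    (A : Euc d →L[ℝ] Euc d →L[ℝ] V) (M : Fin d → Fin d → ℝ) : V :=
  ∑ i : Fin d, ∑ j : Fin d,
    M j i • A (EuclideanSpace.single j (1 : ℝ)) (EuclideanSpace.single i (1 : ℝ))

/-- `g = Λ(h)` for the sewing map `Λ` with exponent `ν`: `g ∈ C₂^ν` and `δg = h` on `[0,T]`.
For `ν > 1` there is at most one such `g`. -/
structure IsSewing {V : Type*} [NormedAddCommGroup V] (T ν : ℝ) (h : ℝ → ℝ → ℝ → V)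
    (g : ℝ → ℝ → V) : Prop where
  holder : Holder₂ T ν g
  delta_eq : ∀ s u t : ℝ, 0 ≤ s → s ≤ u → u ≤ t → t ≤ T → delta g s u t = h s u t

/-- `J_{st} = ∫_s^t μ_u dζ_u` for `0 ≤ s ≤ t ≤ T`, the integral of a weakly controlled path
`(μ, μ^ζ)` against `(ζ, ζ²)`:
`J = μ δζ + μ^ζ ζ² + Λ(ρ^μ δζ + δμ^ζ ζ²)`. -/
def IsRoughIntegral {d : ℕ} {V : Type*} [NormedAddCommGroup V] [NormedSpace ℝ V]
    (T κ : ℝ) (ζ : ℝ → Euc d) (ζ2 : ℝ → ℝ → Fin d → Fin d → ℝ)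
    (μ : ℝ → Euc d →L[ℝ] V) (μ' : ℝ → Euc d →L[ℝ] Euc d →L[ℝ] V)
    (J : ℝ → ℝ → V) : Prop :=
  IsWeaklyControlled T κ ζ μ μ' ∧
  ∃ g : ℝ → ℝ → V,
    IsSewing T (3 * κ)
      (fun s u t => remainder ζ μ μ' s u (incr ζ u t) + areaTerm (incr μ' s u) (ζ2 u t)) g ∧
    ∀ s t : ℝ, 0 ≤ s → s ≤ t → t ≤ T →
      J s t = μ s (incr ζ s t) + areaTerm (μ' s) (ζ2 s t) + g s t

/-- The space `C_b^{p,k}([0,T] × E; F)`: the derivatives of `f` in time up to order `p` and those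
in space up to order `k` exist, are jointly continuous and bounded on `[0,T] × E`. -/
structure IsCb {E F : Type*} [NormedAddCommGroup E] [NormedSpace ℝ E]
    [NormedAddCommGroup F] [NormedSpace ℝ F] (T : ℝ) (p k : ℕ) (f : ℝ → E → F) : Prop where
  contDiff_space : ∀ t ∈ Icc 0 T, ContDiff ℝ k (f t)
  contDiff_time : ∀ x : E, ContDiffOn ℝ p (fun t => f t x) (Icc 0 T)
  continuous_space : ∀ j ≤ k,
    ContinuousOn (fun q : ℝ × E => iteratedFDeriv ℝ j (f q.1) q.2) (Icc 0 T ×ˢ univ)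
  continuous_time : ∀ i ≤ p,
    ContinuousOn (fun q : ℝ × E => iteratedDerivWithin i (fun t => f t q.2) (Icc 0 T) q.1)
      (Icc 0 T ×ˢ univ)
  bounded_space : ∀ j ≤ k, ∃ C : ℝ, ∀ t ∈ Icc 0 T, ∀ x : E, ‖iteratedFDeriv ℝ j (f t) x‖ ≤ C
  bounded_time : ∀ i ≤ p, ∃ C : ℝ, ∀ t ∈ Icc 0 T, ∀ x : E,
    ‖iteratedDerivWithin i (fun r => f r x) (Icc 0 T) t‖ ≤ C

/-- The controlled path `(x, x^ζ) ∈ Q_ζ^κ([0,T]; ℝᵐ)` solves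
`dx_s = b(s, x_s) ds + σ(s, x_s) dζ_s`, `x_0 = y`, as an identity in `Q_ζ^κ`:
the right-hand side is a controlled path with derivative `σ(·, x)`, so `x^ζ = σ(·, x)`, and
`δx_{st} - ∫_s^t b(u, x_u) du` is the rough integral of `σ(·, x)`, whose derivative
is `∇σ(·, x) x^ζ`. -/
structure IsSolution {d m : ℕ} (T κ : ℝ) (ζ : ℝ → Euc d) (ζ2 : ℝ → ℝ → Fin d → Fin d → ℝ)
    (b : ℝ → Euc m → Euc m) (σ : ℝ → Euc m → Euc d →L[ℝ] Euc m) (y : Euc m)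
    (x : ℝ → Euc m) (x' : ℝ → Euc d →L[ℝ] Euc m) : Prop where
  initial : x 0 = y
  controlled : IsWeaklyControlled T κ ζ x x'
  deriv_eq : ∀ s ∈ Icc 0 T, x' s = σ s (x s)
  integral_eq : IsRoughIntegral T κ ζ ζ2 (fun s => σ s (x s))
    (fun s => (fderiv ℝ (σ s) (x s)).comp (x' s))
    (fun s t => incr x s t - ∫ u in s..t, b u (x u))

end RoughDE

/-! Everything rests on the local expansion `δx_{st} = ∫_s^t b du + σ(s,x_s) δζ_{st} + (∇σ σ)(s,x_s)
ζ²_{st} + g_{st}`, `g = O(|t-s|^{3κ})`. By Chen's relation (`germ_delta`) the defect of additivity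
of `g` is exactly the sewing datum of the rough integral. Hence a bounded continuous path with this
expansion over short times is a solution (`isSolution_of_expansion`). Since `3κ > 1`, the remainder
is moreover controlled by its defect (`norm_le_of_norm_delta_le`).

Existence follows Davie's Euler scheme. On a finite set of times the remainder vanishes over single
steps. Its defect is `O(|t-s|^{3κ})`, provided the expansion is already known on the left
subinterval. Induction on the number of steps (`discrete_sewing`), with times closer than a fixed
`ε`, closes this loop and bounds the remainder uniformly in the partition (`euler_expansion`).
Pointwise limits along an ultrafilter of growing finite sets keep the expansion. The limiting drift
has right derivative `b(s,x_s)`, so it is the required integral (`exists_limit_path`).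

For uniqueness, the remainders of two solutions are subtracted. If the paths differ by at most `M`
and the remainder difference is at most `M |t-s|^{2κ}`, the defect is at most a constant times `M
|t-s|^{2/3+κ}`, and `2/3 + κ > 1`. On a short interval starting at a common value, sewing therefore
replaces `M` by `M/2`; iteration gives equality (`IsDifference.eq_of_eq`), and intervals of a fixed
length are chained.

The classes `C_b^{1,2}` and `C_b^{1,3}` contain no mixed derivatives. The Hölder regularity in time
of `∇σ` and `∇²σ` comes from Landau interpolation between the Lipschitz bound in time and the
smoothness in space. The bound `κ ≤ 1/2` makes `|t-s| ≤ |t-s|^{2κ}` and `|t-s|^{1/2} ≤ |t-s|^κ` over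
short times. -/

namespace RoughDE

set_option maxSynthPendingDepth 3

/-! ### Contraction with the Lévy area and Chen's relation -/

section Area

variable {d : ℕ} {V : Type*} [NormedAddCommGroup V] [NormedSpace ℝ V]

lemma areaTerm_sub_left (A B : Euc d →L[ℝ] Euc d →L[ℝ] V) (M : Fin d → Fin d → ℝ) :
    areaTerm (A - B) M = areaTerm A M - areaTerm B M := by
  simp [areaTerm, smul_sub, Finset.sum_sub_distrib]

lemma areaTerm_sub_right (A : Euc d →L[ℝ] Euc d →L[ℝ] V) (M N : Fin d → Fin d → ℝ) :
    areaTerm A (M - N) = areaTerm A M - areaTerm A N := by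
  simp [areaTerm, sub_smul, Finset.sum_sub_distrib]

lemma norm_areaTerm_le (A : Euc d →L[ℝ] Euc d →L[ℝ] V) (M : Fin d → Fin d → ℝ) :
    ‖areaTerm A M‖ ≤ ‖A‖ * ((d : ℝ) ^ 2 * ‖M‖) := by
  have key : ∀ i j : Fin d,
      ‖M j i • A (EuclideanSpace.single j (1 : ℝ)) (EuclideanSpace.single i (1 : ℝ))‖
        ≤ ‖M‖ * ‖A‖ := by
    intro i j
    rw [norm_smul]
    have h1 : ‖M j i‖ ≤ ‖M‖ := (norm_le_pi_norm (M j) i).trans (norm_le_pi_norm M j)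
    have h2 := A.le_opNorm₂ (EuclideanSpace.single j (1 : ℝ)) (EuclideanSpace.single i (1 : ℝ))
    simp only [PiLp.norm_single, norm_one, mul_one] at h2
    gcongr
  calc ‖areaTerm A M‖ ≤ ∑ _i : Fin d, ∑ _j : Fin d, ‖M‖ * ‖A‖ :=
        norm_sum_le_of_le _ fun i _ => norm_sum_le_of_le _ fun j _ => key i j
    _ = ‖A‖ * ((d : ℝ) ^ 2 * ‖M‖) := by
        simp only [Finset.sum_const, Finset.card_univ, Fintype.card_fin, nsmul_eq_mul]; ring

/-- Both vectors are expanded in the standard basis. This turns the product on the right of Chen's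
relation into an evaluation of `A`, as needed in `germ_delta`. -/
lemma areaTerm_mul (A : Euc d →L[ℝ] Euc d →L[ℝ] V) (v w : Euc d) :
    areaTerm A (fun i j => v i * w j) = A v w := by
  have h : ∀ v : Euc d, v = ∑ j, v j • EuclideanSpace.single j (1 : ℝ) := by
    intro v
    have := (EuclideanSpace.basisFun (Fin d) ℝ).sum_repr v
    simpa using this.symm
  conv_rhs => rw [h v, h w]
  simp only [areaTerm, map_sum, map_smul, sum_apply,
    smul_apply, Finset.smul_sum, smul_smul]
  refine Finset.sum_congr rfl fun i _ => Finset.sum_congr rfl fun j _ => ?_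
  rw [mul_comm]

/-- The local expansion of a rough integral fails to be additive by the sewing datum. -/
lemma germ_delta {T α : ℝ} {ζ : ℝ → Euc d} {ζ2 : ℝ → ℝ → Fin d → Fin d → ℝ}
    (hζ : IsGeometricRoughPath T α ζ ζ2) {s u t : ℝ} (hs : 0 ≤ s) (hsu : s ≤ u) (hut : u ≤ t)
    (ht : t ≤ T) (μ₀ μ₁ : Euc d →L[ℝ] V) (A₀ A₁ : Euc d →L[ℝ] Euc d →L[ℝ] V) :
    (μ₀ (incr ζ s u) + areaTerm A₀ (ζ2 s u)) + (μ₁ (incr ζ u t) + areaTerm A₁ (ζ2 u t))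
      - (μ₀ (incr ζ s t) + areaTerm A₀ (ζ2 s t))
      = (μ₁ - μ₀ - A₀ (incr ζ s u)) (incr ζ u t) + areaTerm (A₁ - A₀) (ζ2 u t) := by
  have h1 : areaTerm A₀ (ζ2 s t) - areaTerm A₀ (ζ2 s u) - areaTerm A₀ (ζ2 u t)
      = A₀ (incr ζ s u) (incr ζ u t) := by
    rw [← areaTerm_sub_right, ← areaTerm_sub_right, ← areaTerm_mul]
    congr 1
    ext i j
    exact hζ.chen s u t hs hsu hut ht i j
  have h2 : incr ζ s t = incr ζ s u + incr ζ u t := by simp [incr]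
  rw [areaTerm_sub_left, h2, map_add, sub_apply,
    sub_apply, ← h1]
  abel

end Area

/-! ### Sewing estimates, continuous and discrete -/

section Sewing

variable {V : Type*} [NormedAddCommGroup V]

lemma two_mul_half_rpow {l : ℝ} (hl : 0 ≤ l) (θ : ℝ) :
    2 * (l / 2) ^ θ = 2 ^ (1 - θ) * l ^ θ := by
  rw [Real.div_rpow hl (by norm_num), Real.rpow_sub (by norm_num), Real.rpow_one]
  ring

lemma two_rpow_one_sub_lt_one {θ : ℝ} (hθ : 1 < θ) : (2 : ℝ) ^ (1 - θ) < 1 :=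
  Real.rpow_lt_one_of_one_lt_of_neg (by norm_num) (by linarith)

/-- A two-index map of order `ν > 1` is controlled by its defect of additivity. -/
lemma norm_le_of_norm_delta_le {R : ℝ → ℝ → V} {a b A C θ ν : ℝ} (hθ : 1 < θ) (hν : 1 < ν)
    (hR : ∀ s t, a ≤ s → s ≤ t → t ≤ b → ‖R s t‖ ≤ C * (t - s) ^ ν)
    (hδ : ∀ s u t, a ≤ s → s ≤ u → u ≤ t → t ≤ b → ‖delta R s u t‖ ≤ A * (t - s) ^ θ)
    {s t : ℝ} (hs : a ≤ s) (hst : s ≤ t) (ht : t ≤ b) :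
    ‖R s t‖ ≤ A / (1 - 2 ^ (1 - θ)) * (t - s) ^ θ := by
  set K := A / (1 - (2 : ℝ) ^ (1 - θ)) with hK
  have hq := two_rpow_one_sub_lt_one hθ
  -- `K` is the fixed point of one bisection step: two halves contribute `K * 2 ^ (1 - θ)` and the
  -- defect contributes `A`.
  have hKA : K * 2 ^ (1 - θ) + A = K := by
    have : 1 - (2 : ℝ) ^ (1 - θ) ≠ 0 := by linarith
    rw [hK]; field_simp; ring
  have step : ∀ n : ℕ, ∀ s t, a ≤ s → s ≤ t → t ≤ b →
      ‖R s t‖ ≤ K * (t - s) ^ θ + C * ((2 : ℝ) ^ (1 - ν)) ^ n * (t - s) ^ ν := by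
    intro n
    induction n with
    | zero =>
      intro s t hs hst ht
      have h1 := hR s t hs hst ht
      have h0 : 0 ≤ (t - s) ^ θ := Real.rpow_nonneg (by linarith) _
      have hA : 0 ≤ A * (t - s) ^ θ := (norm_nonneg _).trans (hδ s s t hs le_rfl hst ht)
      have : 0 ≤ K * (t - s) ^ θ := by
        rw [hK, div_mul_eq_mul_div]; exact div_nonneg hA (by linarith)
      simpa using h1.trans (by linarith)
    | succ n ih =>
      intro s t hs hst ht
      set u := (s + t) / 2 with hu
      have e1 : u - s = (t - s) / 2 := by rw [hu]; ring
      have e2 : t - u = (t - s) / 2 := by rw [hu]; ring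
      have h1 := ih s u hs (by linarith) (by linarith)
      have h2 := ih u t (by linarith) (by linarith) ht
      have h3 := hδ s u t hs (by linarith) (by linarith) ht
      rw [e1] at h1
      rw [e2] at h2
      have h4 : R s t = delta R s u t + R s u + R u t := by
        simp only [delta]; abel
      have h5 := two_mul_half_rpow (sub_nonneg.2 hst) θ
      have h6 := two_mul_half_rpow (sub_nonneg.2 hst) ν
      calc ‖R s t‖ ≤ ‖delta R s u t‖ + ‖R s u‖ + ‖R u t‖ := by rw [h4]; exact norm_add₃_le
        _ ≤ A * (t - s) ^ θ + K * (2 * ((t - s) / 2) ^ θ)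
            + C * ((2 : ℝ) ^ (1 - ν)) ^ n * (2 * ((t - s) / 2) ^ ν) := by linarith
        _ = (K * 2 ^ (1 - θ) + A) * (t - s) ^ θ
            + C * ((2 : ℝ) ^ (1 - ν)) ^ (n + 1) * (t - s) ^ ν := by rw [h5, h6]; ring
        _ = _ := by rw [hKA]
  -- Each bisection multiplies the a priori term by `2 ^ (1 - ν) < 1`, so it disappears in the limit
  -- and the size of `C` is irrelevant.
  have hlim : Filter.Tendsto
      (fun n : ℕ => K * (t - s) ^ θ + C * ((2 : ℝ) ^ (1 - ν)) ^ n * (t - s) ^ ν)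
      Filter.atTop (nhds (K * (t - s) ^ θ + C * 0 * (t - s) ^ ν)) :=
    ((tendsto_pow_atTop_nhds_zero_of_lt_one (by positivity)
      (two_rpow_one_sub_lt_one hν)).const_mul C |>.mul_const _).const_add _
  have := ge_of_tendsto' hlim fun n => step n s t hs hst ht
  simpa using this

/-- Take the last `k < j` with `τ k` in the first half of the interval. Then either `τ (k + 1)` lies
beyond the midpoint or `k + 1 = j`. Removing the single step from `k` to `k + 1` leaves two pieces
of at most half the length. -/
lemma exists_split {τ : ℕ → ℝ} (hτ : Monotone τ) {i j : ℕ} (hij : i < j) :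
    ∃ k, i ≤ k ∧ k < j ∧ τ k - τ i ≤ (τ j - τ i) / 2 ∧ τ j - τ (k + 1) ≤ (τ j - τ i) / 2 := by
  classical
  have hle := hτ hij.le
  have hi : τ i - τ i ≤ (τ j - τ i) / 2 := by linarith
  set k := Nat.findGreatest (fun k => τ k - τ i ≤ (τ j - τ i) / 2) (j - 1) with hk
  have hik : i ≤ k := Nat.le_findGreatest (P := fun k => τ k - τ i ≤ (τ j - τ i) / 2)
    (by omega) hi
  have hkj : k ≤ j - 1 := Nat.findGreatest_le _
  refine ⟨k, hik, by omega, Nat.findGreatest_spec (P := fun k => τ k - τ i ≤ (τ j - τ i) / 2)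
    (by omega : i ≤ j - 1) hi, ?_⟩
  rcases hkj.lt_or_eq with h | h
  · have := Nat.findGreatest_is_greatest (P := fun k => τ k - τ i ≤ (τ j - τ i) / 2)
      (Nat.lt_succ_self k) (by omega : k + 1 ≤ j - 1)
    simp only [not_le] at this
    linarith
  · rw [h, Nat.sub_add_cancel (by omega)]
    linarith

/-- Davie's discrete sewing estimate along a partition. -/
lemma discrete_sewing {τ : ℕ → ℝ} (hτ : Monotone τ) {J : ℕ → ℕ → V} {ε A θ : ℝ} (hθ : 1 < θ)
    (h0 : ∀ i, J i i = 0) (h1 : ∀ i, J i (i + 1) = 0)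
    (hδ : ∀ i k j, i ≤ k → k ≤ j → τ j - τ i ≤ ε →
      ‖J i k‖ ≤ 2 * A / (1 - 2 ^ (1 - θ)) * (τ k - τ i) ^ θ →
      ‖J i j - J i k - J k j‖ ≤ A * (τ j - τ i) ^ θ) (hA : 0 ≤ A)
    {i j : ℕ} (hij : i ≤ j) (hε : τ j - τ i ≤ ε) :
    ‖J i j‖ ≤ 2 * A / (1 - 2 ^ (1 - θ)) * (τ j - τ i) ^ θ := by
  have hq := two_rpow_one_sub_lt_one hθ
  set L := 2 * A / (1 - (2 : ℝ) ^ (1 - θ)) with hL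
  -- The term `2 * A` accounts for two defects per splitting, at `k` and at `k + 1`.
  have hLA : L * 2 ^ (1 - θ) + 2 * A = L := by
    have : 1 - (2 : ℝ) ^ (1 - θ) ≠ 0 := by linarith
    rw [hL]; field_simp; ring
  have hL0 : 0 ≤ L := div_nonneg (by linarith) (by linarith)
  obtain ⟨n, rfl⟩ := Nat.exists_eq_add_of_le hij
  clear hij
  induction n using Nat.strong_induction_on generalizing i with
  | _ n ih =>
    rcases Nat.eq_zero_or_pos n with rfl | hn
    · simp [h0, mul_nonneg hL0, Real.rpow_nonneg]
    set j := i + n with hj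
    have hij : i < j := by omega
    obtain ⟨k, hik, hkj, hl, hr⟩ := exists_split hτ hij
    set l := τ j - τ i with hl'
    have hl0 : 0 ≤ l := sub_nonneg.2 (hτ hij.le)
    have mik := hτ hik
    have mkj := hτ hkj
    have mk1 : τ k ≤ τ (k + 1) := hτ (Nat.le_succ k)
    have a1 : ‖J i k‖ ≤ L * (τ k - τ i) ^ θ := by
      obtain ⟨p, rfl⟩ := Nat.exists_eq_add_of_le hik
      exact ih p (by omega) (by linarith)
    have a2 : ‖J (k + 1) j‖ ≤ L * (τ j - τ (k + 1)) ^ θ := by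
      obtain ⟨p, hp⟩ := Nat.exists_eq_add_of_le hkj
      have hp' : j = k + 1 + p := hp
      rw [hp']
      exact ih p (by omega) (by rw [← hp']; linarith)
    have a3 := hδ i k j hik hkj.le hε a1
    -- The a priori bound required by `hδ` is trivial here, since single steps have zero remainder;
    -- for `a3` it is the induction hypothesis `a1`.
    have a4 := hδ k (k + 1) j (Nat.le_succ k) hkj (by linarith) (by
      rw [h1, norm_zero]
      exact mul_nonneg hL0 (Real.rpow_nonneg (by linarith) _))
    have r1 : (τ k - τ i) ^ θ ≤ (l / 2) ^ θ :=
      Real.rpow_le_rpow (by linarith) hl (by linarith)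
    have r2 : (τ j - τ (k + 1)) ^ θ ≤ (l / 2) ^ θ :=
      Real.rpow_le_rpow (sub_nonneg.2 (hτ hkj)) hr (by linarith)
    have r3 : (τ j - τ k) ^ θ ≤ l ^ θ := Real.rpow_le_rpow (by linarith [hτ hkj.le]) (by linarith)
      (by linarith)
    have e : J i j = (J i j - J i k - J k j) + (J k j - J k (k + 1) - J (k + 1) j)
        + J i k + J (k + 1) j := by rw [h1]; abel
    calc ‖J i j‖ ≤ ‖J i j - J i k - J k j‖ + ‖J k j - J k (k + 1) - J (k + 1) j‖
          + ‖J i k‖ + ‖J (k + 1) j‖ := by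
          conv_lhs => rw [e]
          exact norm_add₄_le
      _ ≤ A * l ^ θ + A * l ^ θ + L * (l / 2) ^ θ + L * (l / 2) ^ θ := by
          have := mul_le_mul_of_nonneg_left r1 hL0
          have := mul_le_mul_of_nonneg_left r2 hL0
          have := mul_le_mul_of_nonneg_left r3 hA
          linarith
      _ = L * (2 * (l / 2) ^ θ) + 2 * A * l ^ θ := by ring
      _ = (L * 2 ^ (1 - θ) + 2 * A) * l ^ θ := by rw [two_mul_half_rpow hl0]; ring
      _ = L * l ^ θ := by rw [hLA]

end Sewing

/-! ### Hölder classes of paths and two-index maps -/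

section Holder

variable {V : Type*} [NormedAddCommGroup V]

lemma Holder₂.exists_nonneg {T μ : ℝ} {f : ℝ → ℝ → V} (h : Holder₂ T μ f) :
    ∃ C : ℝ, 0 ≤ C ∧ ∀ s t : ℝ, 0 ≤ s → s ≤ t → t ≤ T → ‖f s t‖ ≤ C * (t - s) ^ μ := by
  obtain ⟨C, hC⟩ := h
  refine ⟨max C 0, le_max_right _ _, fun s t hs hst ht => (hC s t hs hst ht).trans ?_⟩
  exact mul_le_mul_of_nonneg_right (le_max_left _ _) (Real.rpow_nonneg (by linarith) _)

lemma rpow_le_mul_rpow {T l p q : ℝ} (hl : 0 ≤ l) (hlT : l ≤ T) (hq : 0 < q) (hqp : q ≤ p) :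
    l ^ p ≤ T ^ (p - q) * l ^ q := by
  have h : l ^ p = l ^ (p - q) * l ^ q := by
    rcases hl.eq_or_lt with rfl | h
    · rw [Real.zero_rpow (by linarith), Real.zero_rpow hq.ne', mul_zero]
    · rw [← Real.rpow_add h]; ring_nf
  rw [h]
  exact mul_le_mul_of_nonneg_right (Real.rpow_le_rpow hl hlT (by linarith))
    (Real.rpow_nonneg hl _)

lemma Holder₂.mono {T p q : ℝ} {f : ℝ → ℝ → V} (h : Holder₂ T p f) (hq : 0 < q)
    (hqp : q ≤ p) : Holder₂ T q f := by
  obtain ⟨C, hC0, hC⟩ := h.exists_nonneg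
  refine ⟨C * T ^ (p - q), fun s t hs hst ht => (hC s t hs hst ht).trans ?_⟩
  rw [mul_assoc]
  exact mul_le_mul_of_nonneg_left
    (rpow_le_mul_rpow (sub_nonneg.2 hst) (by linarith) hq hqp) hC0

lemma Holder₂.of_le {W : Type*} [NormedAddCommGroup W] {T p : ℝ} {f : ℝ → ℝ → V}
    {g : ℝ → ℝ → W} (c : ℝ) (hg : Holder₂ T p g)
    (h : ∀ s t, 0 ≤ s → s ≤ t → t ≤ T → ‖f s t‖ ≤ c * ‖g s t‖) : Holder₂ T p f := by
  obtain ⟨C, hC0, hC⟩ := hg.exists_nonneg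
  refine ⟨|c| * C, fun s t hs hst ht => (h s t hs hst ht).trans ?_⟩
  have := hC s t hs hst ht
  calc c * ‖g s t‖ ≤ |c| * ‖g s t‖ := by gcongr; exact le_abs_self c
    _ ≤ |c| * (C * (t - s) ^ p) := by gcongr
    _ = _ := by ring

lemma Holder₂.add {T p : ℝ} {f g : ℝ → ℝ → V} (hf : Holder₂ T p f) (hg : Holder₂ T p g) :
    Holder₂ T p (fun s t => f s t + g s t) := by
  obtain ⟨C, hC⟩ := hf
  obtain ⟨D, hD⟩ := hg
  refine ⟨C + D, fun s t hs hst ht => ?_⟩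
  have := hC s t hs hst ht
  have := hD s t hs hst ht
  linarith [norm_add_le (f s t) (g s t)]

lemma Holder₁.continuousOn {T p : ℝ} {g : ℝ → V} (hp : 0 < p) (h : Holder₁ T p g) :
    ContinuousOn g (Icc 0 T) := by
  obtain ⟨C, hC0, hC⟩ := Holder₂.exists_nonneg h
  have key : ∀ s ∈ Icc (0 : ℝ) T, ∀ t ∈ Icc (0 : ℝ) T, ‖g t - g s‖ ≤ C * |t - s| ^ p := by
    intro s hs t ht
    rcases le_total s t with hst | hst
    · rw [abs_of_nonneg (by linarith)]; exact hC s t hs.1 hst ht.2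
    · rw [norm_sub_rev, abs_sub_comm, abs_of_nonneg (by linarith)]; exact hC t s ht.1 hst hs.2
  intro s hs
  refine tendsto_iff_norm_sub_tendsto_zero.2 ?_
  have hcont : Filter.Tendsto (fun t => C * |t - s| ^ p) (nhdsWithin s (Icc 0 T)) (nhds 0) := by
    have : ContinuousAt (fun t => C * |t - s| ^ p) s :=
      continuousAt_const.mul (ContinuousAt.rpow_const (by fun_prop) (Or.inr hp.le))
    have h2 : Filter.Tendsto (fun t => C * |t - s| ^ p) (nhds s) (nhds 0) := by
      simpa [ContinuousAt, Real.zero_rpow hp.ne'] using this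
    exact h2.mono_left nhdsWithin_le_nhds
  exact squeeze_zero' (Filter.Eventually.of_forall fun _ => norm_nonneg _)
    (Filter.eventually_of_mem self_mem_nhdsWithin fun t ht => key s hs t ht) hcont

end Holder

/-! ### Interpolation inequalities and difference estimates for smooth maps -/

section Calculus

variable {E G : Type*} [NormedAddCommGroup E] [NormedSpace ℝ E]
  [NormedAddCommGroup G] [NormedSpace ℝ G]

lemma norm_sub_le_of_norm_fderiv_le {f : E → G} {C : ℝ} (hf : Differentiable ℝ f)
    (hC : ∀ x, ‖fderiv ℝ f x‖ ≤ C) (x y : E) : ‖f y - f x‖ ≤ C * ‖y - x‖ :=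
  convex_univ.norm_image_sub_le_of_norm_fderiv_le (fun z _ => hf z) (fun z _ => hC z)
    (mem_univ x) (mem_univ y)

lemma norm_taylor_one_le {f : E → G} {B : ℝ} (hB : 0 ≤ B) (hf : Differentiable ℝ f)
    (hf' : ∀ x y, ‖fderiv ℝ f y - fderiv ℝ f x‖ ≤ B * ‖y - x‖) (x y : E) :
    ‖f y - f x - fderiv ℝ f x (y - x)‖ ≤ B * ‖y - x‖ ^ 2 := by
  have := (convex_closedBall x ‖y - x‖).norm_image_sub_le_of_norm_fderiv_le'
    (f := f) (φ := fderiv ℝ f x) (C := B * ‖y - x‖) (x := x) (y := y) (fun z _ => hf z)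
    (fun z hz => (hf' x z).trans (mul_le_mul_of_nonneg_left (mem_closedBall_iff_norm.1 hz) hB))
    (Metric.mem_closedBall_self (norm_nonneg _)) (mem_closedBall_iff_norm.2 le_rfl)
  calc _ ≤ _ := this
    _ = _ := by ring

/-- Landau's interpolation inequality for the first derivative. -/
lemma norm_fderiv_le_interpolation {f : E → G} {A B h : ℝ} (hB : 0 ≤ B) (hh : 0 < h)
    (hf : Differentiable ℝ f) (hA : ∀ x, ‖f x‖ ≤ A)
    (hf' : ∀ x y, ‖fderiv ℝ f y - fderiv ℝ f x‖ ≤ B * ‖y - x‖) (x : E) :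
    ‖fderiv ℝ f x‖ ≤ 2 * A / h + B * h := by
  have hA0 : 0 ≤ A := (norm_nonneg _).trans (hA x)
  refine ContinuousLinearMap.opNorm_le_of_unit_norm (by positivity) fun v hv => ?_
  have h1 := norm_taylor_one_le hB hf hf' x (x + h • v)
  rw [add_sub_cancel_left, norm_smul, hv, mul_one, Real.norm_of_nonneg hh.le, map_smul] at h1
  have h2 : ‖h • fderiv ℝ f x v‖ ≤ 2 * A + B * h ^ 2 := by
    have e : h • fderiv ℝ f x v
        = f (x + h • v) - f x - (f (x + h • v) - f x - h • fderiv ℝ f x v) := by abel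
    rw [e]
    refine (norm_sub_le _ _).trans (add_le_add ((norm_sub_le _ _).trans ?_) h1)
    linarith [hA x, hA (x + h • v)]
  rw [norm_smul, Real.norm_of_nonneg hh.le] at h2
  have : 2 * A / h + B * h = (2 * A + B * h ^ 2) / h := by field_simp
  rw [this, le_div_iff₀ hh]
  linarith

/-- Landau's interpolation inequality for the first two derivatives. -/
lemma norm_fderiv_le_interpolation₃ {f : E → G} {A B C h : ℝ} (hB : 0 ≤ B) (hh : 0 < h)
    (hf : Differentiable ℝ f) (hf2 : Differentiable ℝ (fderiv ℝ f)) (hA : ∀ x, ‖f x‖ ≤ A)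
    (hC : ∀ x, ‖fderiv ℝ f x‖ ≤ C) (hC2 : ∀ x, ‖fderiv ℝ (fderiv ℝ f) x‖ ≤ C)
    (hf' : ∀ x y, ‖fderiv ℝ (fderiv ℝ f) y - fderiv ℝ (fderiv ℝ f) x‖ ≤ B * ‖y - x‖) (x : E) :
    ‖fderiv ℝ f x‖ ≤ 4 * A / h + 8 * B * h ^ 2 ∧
      ‖fderiv ℝ (fderiv ℝ f) x‖ ≤ 2 * A / h ^ 2 + 8 * B * h := by
  -- The constant `C` serves only to make these suprema finite, so that `B₁` can be absorbed below;
  -- it is absent from the final bounds.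
  set B₁ := ⨆ x, ‖fderiv ℝ f x‖ with hB₁
  set B₂ := ⨆ x, ‖fderiv ℝ (fderiv ℝ f) x‖ with hB₂
  have le₁ : ∀ x, ‖fderiv ℝ f x‖ ≤ B₁ := fun x => le_ciSup ⟨C, by rintro _ ⟨y, rfl⟩; exact hC y⟩ x
  have le₂ : ∀ x, ‖fderiv ℝ (fderiv ℝ f) x‖ ≤ B₂ :=
    fun x => le_ciSup ⟨C, by rintro _ ⟨y, rfl⟩; exact hC2 y⟩ x
  have n₂ : 0 ≤ B₂ := (norm_nonneg _).trans (le₂ x)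
  have i₁ : B₁ ≤ 2 * A / h + B₂ * h := ciSup_le fun x =>
    norm_fderiv_le_interpolation n₂ hh hf hA (norm_sub_le_of_norm_fderiv_le hf2 le₂) x
  -- The step `4 * h` makes the coefficient of `B₁` equal to `1 / 2` once this bound is inserted
  -- into `i₁`.
  have i₂ : B₂ ≤ 2 * B₁ / (4 * h) + B * (4 * h) := ciSup_le fun x =>
    norm_fderiv_le_interpolation hB (by positivity) hf2 le₁ hf' x
  have e₂ : 2 * B₁ / (4 * h) = B₁ / h / 2 := by field_simp; ring
  have j₁ : B₁ ≤ 4 * A / h + 8 * B * h ^ 2 := by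
    have : B₂ * h ≤ (B₁ / h / 2 + B * (4 * h)) * h :=
      mul_le_mul_of_nonneg_right (by linarith) hh.le
    have e : (B₁ / h / 2 + B * (4 * h)) * h = B₁ / 2 + 4 * B * h ^ 2 := by field_simp
    have e' : 4 * A / h = 2 * (2 * A / h) := by ring
    linarith
  refine ⟨(le₁ x).trans j₁, (le₂ x).trans (i₂.trans ?_)⟩
  have : B₁ / h ≤ (4 * A / h + 8 * B * h ^ 2) / h := div_le_div_of_nonneg_right j₁ hh.le
  have e : (4 * A / h + 8 * B * h ^ 2) / h = 2 * (2 * A / h ^ 2) + 8 * B * h := by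
    field_simp; ring
  rw [e₂]
  linarith

/-- The four-point estimate for functions with bounded and Lipschitz derivative. -/
lemma norm_four_point_le {f : E → G} {K : ℝ} (hf : Differentiable ℝ f)
    (hK : ∀ x, ‖fderiv ℝ f x‖ ≤ K)
    (hf' : ∀ x y, ‖fderiv ℝ f y - fderiv ℝ f x‖ ≤ K * ‖y - x‖) (a b c d : E) :
    ‖f a - f b - (f c - f d)‖ ≤ K * ‖a - b - (c - d)‖ + K * ‖a - b‖ * ‖b - d‖ := by
  have h1 := norm_sub_le_of_norm_fderiv_le hf hK c (d + (a - b))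
  -- The map `y ↦ f (y + (a - b)) - f y` has derivative of size `K * ‖a - b‖`; comparing its values
  -- at `b` and `d` gives the second term of the bound.
  have hshift : ∀ z, HasFDerivAt (fun y => f (y + (a - b))) (fderiv ℝ f (z + (a - b))) z :=
    fun z => (hasFDerivAt_comp_add_right (a - b)).2 (hf (z + (a - b))).hasFDerivAt
  have hd : ∀ z, HasFDerivAt (fun y => f (y + (a - b)) - f y)
      (fderiv ℝ f (z + (a - b)) - fderiv ℝ f z) z :=
    fun z => (hshift z).sub (hf z).hasFDerivAt
  have h2 := norm_sub_le_of_norm_fderiv_le (f := fun y => f (y + (a - b)) - f y)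
    (C := K * ‖a - b‖) (fun z => (hd z).differentiableAt) (fun z => by
      rw [(hd z).fderiv]; simpa using hf' z (z + (a - b))) d b
  have e : f a - f b - (f c - f d)
      = (f (d + (a - b)) - f c) + (f (b + (a - b)) - f b - (f (d + (a - b)) - f d)) := by
    rw [add_sub_cancel b a]; abel
  have e1 : d + (a - b) - c = a - b - (c - d) := by abel
  rw [e1] at h1
  rw [e]
  exact (norm_add_le _ _).trans (add_le_add h1 h2)

/-- The difference of two first order Taylor remainders. -/
lemma norm_taylor_sub_taylor_le {f : E → G} {K M : ℝ} (hf : Differentiable ℝ f)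
    (hf2 : Differentiable ℝ (fderiv ℝ f)) (hK : ∀ x, ‖fderiv ℝ (fderiv ℝ f) x‖ ≤ K)
    (hK' : ∀ x y, ‖fderiv ℝ (fderiv ℝ f) y - fderiv ℝ (fderiv ℝ f) x‖ ≤ K * ‖y - x‖)
    {x₁ x₂ h₁ h₂ : E} (hs : ‖x₁ - x₂‖ ≤ M) (hu : ‖(x₁ + h₁) - (x₂ + h₂)‖ ≤ M) :
    ‖(f (x₁ + h₁) - f x₁ - fderiv ℝ f x₁ h₁) - (f (x₂ + h₂) - f x₂ - fderiv ℝ f x₂ h₂)‖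
      ≤ K * (‖h₁ - h₂‖ + M * ‖h₂‖) * ‖h₁‖ + K * ‖h₂‖ * ‖h₁ - h₂‖ := by
  have hK0 : 0 ≤ K := (norm_nonneg _).trans (hK x₁)
  have hM0 : 0 ≤ M := (norm_nonneg _).trans hs
  have hder : ∀ x h : E, ∀ r : ℝ, HasDerivAt (fun r : ℝ => f (x + r • h) - f x - r • fderiv ℝ f x h)
      (fderiv ℝ f (x + r • h) h - fderiv ℝ f x h) r := by
    intro x h r
    have hline : HasDerivAt (fun r : ℝ => x + r • h) h r := by
      simpa using ((hasDerivAt_id r).smul_const h).const_add x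
    have h1 : HasDerivAt (fun r : ℝ => f (x + r • h)) (fderiv ℝ f (x + r • h) h) r :=
      (hf (x + r • h)).hasFDerivAt.comp_hasDerivAt r hline
    have h2 : HasDerivAt (fun r : ℝ => r • fderiv ℝ f x h) (fderiv ℝ f x h) r := by
      simpa using (hasDerivAt_id r).smul_const (fderiv ℝ f x h)
    exact (h1.sub_const _).sub h2
  -- The remainders are joined to zero along `r ∈ [0,1]`. It then suffices to bound the derivative
  -- of their difference in `r`.
  have key := norm_image_sub_le_of_norm_deriv_le_segment_01'
    (f := fun r : ℝ => (f (x₁ + r • h₁) - f x₁ - r • fderiv ℝ f x₁ h₁)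
      - (f (x₂ + r • h₂) - f x₂ - r • fderiv ℝ f x₂ h₂))
    (C := K * (‖h₁ - h₂‖ + M * ‖h₂‖) * ‖h₁‖ + K * ‖h₂‖ * ‖h₁ - h₂‖)
    (fun r _ => ((hder x₁ h₁ r).sub (hder x₂ h₂ r)).hasDerivWithinAt) (by
      intro r hr
      have hr0 := hr.1
      have hr1 := hr.2.le
      -- By convexity, closeness at the endpoints `r = 0` and `r = 1` gives closeness on the whole
      -- segment.
      have hcvx : ‖(x₁ + r • h₁) - (x₂ + r • h₂)‖ ≤ M := by
        have e : (x₁ + r • h₁) - (x₂ + r • h₂)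
            = (1 - r) • (x₁ - x₂) + r • ((x₁ + h₁) - (x₂ + h₂)) := by module
        rw [e]
        refine (norm_add_le _ _).trans ?_
        rw [norm_smul, norm_smul, Real.norm_of_nonneg hr0, Real.norm_of_nonneg (by linarith)]
        nlinarith
      have h4 := norm_four_point_le hf2 hK hK' (x₁ + r • h₁) (x₂ + r • h₂) x₁ x₂
      have e1 : x₁ + r • h₁ - (x₂ + r • h₂) - (x₁ - x₂) = r • (h₁ - h₂) := by module
      have hrh : ∀ v : E, ‖r • v‖ ≤ ‖v‖ := fun v => by
        rw [norm_smul, Real.norm_of_nonneg hr0]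
        exact mul_le_of_le_one_left (norm_nonneg _) hr1
      rw [e1, add_sub_cancel_left] at h4
      have h4' : ‖fderiv ℝ f (x₁ + r • h₁) - fderiv ℝ f (x₂ + r • h₂)
          - (fderiv ℝ f x₁ - fderiv ℝ f x₂)‖ ≤ K * (‖h₁ - h₂‖ + M * ‖h₂‖) := by
        refine h4.trans ?_
        have := hrh (h₁ - h₂)
        have := hrh h₂
        calc _ ≤ K * ‖h₁ - h₂‖ + K * M * ‖h₂‖ := by gcongr
          _ = _ := by ring
      have h5 : ‖fderiv ℝ f (x₂ + r • h₂) - fderiv ℝ f x₂‖ ≤ K * ‖h₂‖ := by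
        refine (norm_sub_le_of_norm_fderiv_le hf2 hK x₂ (x₂ + r • h₂)).trans ?_
        rw [add_sub_cancel_left]
        exact mul_le_mul_of_nonneg_left (hrh h₂) hK0
      have e2 : fderiv ℝ f (x₁ + r • h₁) h₁ - fderiv ℝ f x₁ h₁
          - (fderiv ℝ f (x₂ + r • h₂) h₂ - fderiv ℝ f x₂ h₂)
          = (fderiv ℝ f (x₁ + r • h₁) - fderiv ℝ f (x₂ + r • h₂)
            - (fderiv ℝ f x₁ - fderiv ℝ f x₂)) h₁
            + (fderiv ℝ f (x₂ + r • h₂) - fderiv ℝ f x₂) (h₁ - h₂) := by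
        simp only [sub_apply, map_sub]; abel
      rw [e2]
      exact (norm_add_le _ _).trans (add_le_add (ContinuousLinearMap.le_of_opNorm_le _ h4' _)
        (ContinuousLinearMap.le_of_opNorm_le _ h5 _)))
  simpa using key

end Calculus

/-! ### Quantitative bounds extracted from `C_b^{p,k}` -/

section Coefficients

variable {E W : Type*} [NormedAddCommGroup E] [NormedSpace ℝ E]
  [NormedAddCommGroup W] [NormedSpace ℝ W]

/-- Bounds available for coefficients in `C_b^{1,2}`, all with the same constant. -/
structure CoeffBound (T K : ℝ) (σ : ℝ → E → W →L[ℝ] E) : Prop where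
  nonneg : 0 ≤ K
  differentiable : ∀ t ∈ Icc 0 T, Differentiable ℝ (σ t)
  norm_le : ∀ t ∈ Icc 0 T, ∀ x, ‖σ t x‖ ≤ K
  fderiv_le : ∀ t ∈ Icc 0 T, ∀ x, ‖fderiv ℝ (σ t) x‖ ≤ K
  fderiv_lip : ∀ t ∈ Icc 0 T, ∀ x y, ‖fderiv ℝ (σ t) y - fderiv ℝ (σ t) x‖ ≤ K * ‖y - x‖
  time_lip : ∀ s ∈ Icc 0 T, ∀ t ∈ Icc 0 T, ∀ x, ‖σ t x - σ s x‖ ≤ K * |t - s|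
  fderiv_time : ∀ s ∈ Icc 0 T, ∀ t ∈ Icc 0 T, ∀ x,
    ‖fderiv ℝ (σ t) x - fderiv ℝ (σ s) x‖ ≤ K * |t - s| ^ (1 / 2 : ℝ)

/-- Bounds available for coefficients in `C_b^{1,3}`, all with the same constant. -/
structure CoeffBound₃ (T K : ℝ) (σ : ℝ → E → W →L[ℝ] E) : Prop extends CoeffBound T K σ where
  differentiable₂ : ∀ t ∈ Icc 0 T, Differentiable ℝ (fderiv ℝ (σ t))
  fderiv₂_le : ∀ t ∈ Icc 0 T, ∀ x, ‖fderiv ℝ (fderiv ℝ (σ t)) x‖ ≤ K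
  fderiv₂_lip : ∀ t ∈ Icc 0 T, ∀ x y,
    ‖fderiv ℝ (fderiv ℝ (σ t)) y - fderiv ℝ (fderiv ℝ (σ t)) x‖ ≤ K * ‖y - x‖
  fderiv_time₃ : ∀ s ∈ Icc 0 T, ∀ t ∈ Icc 0 T, ∀ x,
    ‖fderiv ℝ (σ t) x - fderiv ℝ (σ s) x‖ ≤ K * |t - s| ^ (2 / 3 : ℝ)
  fderiv₂_time : ∀ s ∈ Icc 0 T, ∀ t ∈ Icc 0 T, ∀ x,
    ‖fderiv ℝ (fderiv ℝ (σ t)) x - fderiv ℝ (fderiv ℝ (σ s)) x‖ ≤ K * |t - s| ^ (1 / 3 : ℝ)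

section Cb

variable {F : Type*} [NormedAddCommGroup F] [NormedSpace ℝ F] {T : ℝ} {p k : ℕ} {f : ℝ → E → F}

lemma IsCb.exists_bound (h : IsCb T p k f) :
    ∃ C, 0 ≤ C ∧ ∀ j ≤ k, ∀ t ∈ Icc 0 T, ∀ x, ‖iteratedFDeriv ℝ j (f t) x‖ ≤ C := by
  choose! C hC using h.bounded_space
  refine ⟨∑ j ∈ Finset.range (k + 1), |C j|, Finset.sum_nonneg fun _ _ => abs_nonneg _,
    fun j hj t ht x => (hC j hj t ht x).trans ((le_abs_self _).trans ?_)⟩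
  exact Finset.single_le_sum (f := fun j => |C j|) (fun _ _ => abs_nonneg _)
    (Finset.mem_range.2 (by omega))

lemma IsCb.exists_time_lip (h : IsCb T p k f) (hp : 1 ≤ p) :
    ∃ C, 0 ≤ C ∧ ∀ s ∈ Icc 0 T, ∀ t ∈ Icc 0 T, ∀ x, ‖f t x - f s x‖ ≤ C * |t - s| := by
  obtain ⟨C, hC⟩ := h.bounded_time 1 hp
  refine ⟨|C|, abs_nonneg C, fun s hs t ht x => ?_⟩
  refine (convex_Icc 0 T).norm_image_sub_le_of_norm_derivWithin_le (f := fun r => f r x)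
    ((h.contDiff_time x).differentiableOn (by exact_mod_cast (by omega : p ≠ 0)))
    (fun r hr => ?_) hs ht
  have := hC r hr x
  rw [iteratedDerivWithin_one] at this
  exact this.trans (le_abs_self C)

lemma IsCb.differentiable (h : IsCb T p k f) (hk : 1 ≤ k) {t : ℝ} (ht : t ∈ Icc 0 T) :
    Differentiable ℝ (f t) :=
  (h.contDiff_space t ht).differentiable (by exact_mod_cast (by omega : k ≠ 0))

lemma IsCb.contDiff_fderiv (h : IsCb T p k f) {n : ℕ} (hk : n + 1 ≤ k) {t : ℝ}
    (ht : t ∈ Icc 0 T) : ContDiff ℝ n (fderiv ℝ (f t)) :=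
  (h.contDiff_space t ht).fderiv_right (by exact_mod_cast hk)

lemma norm_fderiv_eq_iteratedFDeriv (g : E → F) (x : E) :
    ‖fderiv ℝ g x‖ = ‖iteratedFDeriv ℝ 1 g x‖ := by
  rw [← norm_iteratedFDeriv_fderiv, norm_iteratedFDeriv_zero]

lemma norm_fderiv₂_eq_iteratedFDeriv (g : E → F) (x : E) :
    ‖fderiv ℝ (fderiv ℝ g) x‖ = ‖iteratedFDeriv ℝ 2 g x‖ := by
  rw [norm_fderiv_eq_iteratedFDeriv, norm_iteratedFDeriv_fderiv]

lemma norm_fderiv₃_eq_iteratedFDeriv (g : E → F) (x : E) :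
    ‖fderiv ℝ (fderiv ℝ (fderiv ℝ g)) x‖ = ‖iteratedFDeriv ℝ 3 g x‖ := by
  rw [norm_fderiv₂_eq_iteratedFDeriv, norm_iteratedFDeriv_fderiv]

lemma IsCb.continuousOn (h : IsCb T p k f) :
    ContinuousOn (fun q : ℝ × E => f q.1 q.2) (Icc 0 T ×ˢ univ) := by
  have := h.continuous_space 0 (Nat.zero_le k)
  refine ((continuousMultilinearCurryFin0 ℝ E F).continuous.comp_continuousOn this).congr ?_
  intro q _
  simp

end Cb

/-- The time regularity of the gradient is obtained by interpolation: `σ t - σ s` is uniformly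
`O(|t-s|)`, and its gradient is Lipschitz uniformly in `s, t`. -/
lemma IsCb.exists_coeffBound {T : ℝ} {σ : ℝ → E → W →L[ℝ] E} {k : ℕ} (hk : 2 ≤ k)
    (h : IsCb T 1 k σ) : ∃ K, CoeffBound T K σ := by
  obtain ⟨C, hC0, hC⟩ := h.exists_bound
  obtain ⟨D, hD0, hD⟩ := h.exists_time_lip le_rfl
  have d1 : ∀ t ∈ Icc 0 T, Differentiable ℝ (σ t) := fun t ht => h.differentiable (by omega) ht
  have d2 : ∀ t ∈ Icc 0 T, Differentiable ℝ (fderiv ℝ (σ t)) := fun t ht =>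
    (h.contDiff_fderiv (n := 1) hk ht).differentiable (by norm_num)
  have lip : ∀ t ∈ Icc 0 T, ∀ x y, ‖fderiv ℝ (σ t) y - fderiv ℝ (σ t) x‖ ≤ C * ‖y - x‖ :=
    fun t ht => norm_sub_le_of_norm_fderiv_le (d2 t ht) fun x => by
      rw [norm_fderiv₂_eq_iteratedFDeriv]; exact hC 2 hk t ht x
  refine ⟨2 * D + 2 * C, by positivity, d1, fun t ht x => ?_, fun t ht x => ?_,
    fun t ht x y => ?_, fun s hs t ht x => ?_, fun s hs t ht x => ?_⟩
  · have := hC 0 (by omega) t ht x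
    rw [norm_iteratedFDeriv_zero] at this
    linarith
  · have := hC 1 (by omega) t ht x
    rw [← norm_fderiv_eq_iteratedFDeriv] at this
    linarith
  · exact (lip t ht x y).trans (by gcongr; linarith)
  · exact (hD s hs t ht x).trans (by gcongr; linarith)
  · rcases eq_or_ne t s with rfl | hts
    · simp
    have hl : 0 < |t - s| := abs_pos.2 (sub_ne_zero.2 hts)
    set w := |t - s| ^ (1 / 2 : ℝ) with hw
    have hw0 : 0 < w := Real.rpow_pos_of_pos hl _
    have hww : |t - s| = w * w := by
      rw [hw, ← Real.rpow_add hl]; norm_num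
    have hsub : ∀ x, fderiv ℝ (fun x => σ t x - σ s x) x = fderiv ℝ (σ t) x - fderiv ℝ (σ s) x :=
      fun x => fderiv_fun_sub (d1 t ht x) (d1 s hs x)
    -- The step `|t - s| ^ (1/2)` balances `|t - s| / h` against `h`.
    have := norm_fderiv_le_interpolation (f := fun x => σ t x - σ s x) (A := D * |t - s|)
      (B := 2 * C) (h := w) (by positivity) hw0 ((d1 t ht).sub (d1 s hs)) (hD s hs t ht)
      (fun x y => by
        rw [hsub, hsub]
        have e : fderiv ℝ (σ t) y - fderiv ℝ (σ s) y - (fderiv ℝ (σ t) x - fderiv ℝ (σ s) x)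
          = (fderiv ℝ (σ t) y - fderiv ℝ (σ t) x) - (fderiv ℝ (σ s) y - fderiv ℝ (σ s) x) := by abel
        rw [e]
        refine (norm_sub_le _ _).trans ?_
        linarith [lip t ht x y, lip s hs x y]) x
    rw [hsub, hww] at this
    refine this.trans (le_of_eq ?_)
    field_simp

/-- With a Lipschitz second derivative, interpolation improves the time exponent of the gradient
from `1/2` to `2/3` and gives `1/3` for the second derivative. -/
lemma IsCb.exists_coeffBound₃ {T : ℝ} {σ : ℝ → E → W →L[ℝ] E}
    (h : IsCb T 1 3 σ) : ∃ K, CoeffBound₃ T K σ := by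
  obtain ⟨K, hK⟩ := h.exists_coeffBound (by norm_num)
  obtain ⟨C, hC0, hC⟩ := h.exists_bound
  obtain ⟨D, hD0, hD⟩ := h.exists_time_lip le_rfl
  have hK0 := hK.nonneg
  have d1 := hK.differentiable
  have d2 : ∀ t ∈ Icc 0 T, Differentiable ℝ (fderiv ℝ (σ t)) := fun t ht =>
    (h.contDiff_fderiv (n := 2) le_rfl ht).differentiable (by norm_num)
  have d3 : ∀ t ∈ Icc 0 T, Differentiable ℝ (fderiv ℝ (fderiv ℝ (σ t))) := fun t ht =>
    ((h.contDiff_fderiv (n := 2) le_rfl ht).fderiv_right (m := 1) (by norm_num)).differentiable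
      (by norm_num)
  have b1 : ∀ t ∈ Icc 0 T, ∀ x, ‖fderiv ℝ (σ t) x‖ ≤ C := fun t ht x => by
    rw [norm_fderiv_eq_iteratedFDeriv]; exact hC 1 (by norm_num) t ht x
  have b2 : ∀ t ∈ Icc 0 T, ∀ x, ‖fderiv ℝ (fderiv ℝ (σ t)) x‖ ≤ C := fun t ht x => by
    rw [norm_fderiv₂_eq_iteratedFDeriv]; exact hC 2 (by norm_num) t ht x
  have lip : ∀ t ∈ Icc 0 T, ∀ x y,
      ‖fderiv ℝ (fderiv ℝ (σ t)) y - fderiv ℝ (fderiv ℝ (σ t)) x‖ ≤ C * ‖y - x‖ :=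
    fun t ht => norm_sub_le_of_norm_fderiv_le (d3 t ht) fun x => by
      rw [norm_fderiv₃_eq_iteratedFDeriv]; exact hC 3 le_rfl t ht x
  have time : ∀ s ∈ Icc 0 T, ∀ t ∈ Icc 0 T, ∀ x,
      ‖fderiv ℝ (σ t) x - fderiv ℝ (σ s) x‖ ≤ (4 * D + 16 * C) * |t - s| ^ (2 / 3 : ℝ) ∧
      ‖fderiv ℝ (fderiv ℝ (σ t)) x - fderiv ℝ (fderiv ℝ (σ s)) x‖
        ≤ (4 * D + 16 * C) * |t - s| ^ (1 / 3 : ℝ) := by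
    intro s hs t ht x
    rcases eq_or_ne t s with rfl | hts
    · simp
    have hl : 0 < |t - s| := abs_pos.2 (sub_ne_zero.2 hts)
    set w := |t - s| ^ (1 / 3 : ℝ) with hw
    have hw0 : 0 < w := Real.rpow_pos_of_pos hl _
    have hw2 : |t - s| ^ (2 / 3 : ℝ) = w ^ 2 := by
      rw [hw, ← Real.rpow_mul_natCast hl.le]; norm_num
    have hw3 : |t - s| = w ^ 3 := by
      rw [hw, ← Real.rpow_mul_natCast hl.le]; norm_num
    have hsub : fderiv ℝ (fun x => σ t x - σ s x) = fun x => fderiv ℝ (σ t) x - fderiv ℝ (σ s) x :=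
      funext fun x => fderiv_fun_sub (d1 t ht x) (d1 s hs x)
    have hsub2 : ∀ x, fderiv ℝ (fun x => fderiv ℝ (σ t) x - fderiv ℝ (σ s) x) x
        = fderiv ℝ (fderiv ℝ (σ t)) x - fderiv ℝ (fderiv ℝ (σ s)) x :=
      fun x => fderiv_fun_sub (d2 t ht x) (d2 s hs x)
    -- The step `|t - s| ^ (1/3)` balances `|t - s| / h` against `h ^ 2`, and `|t - s| / h ^ 2`
    -- against `h`.
    have := norm_fderiv_le_interpolation₃ (f := fun x => σ t x - σ s x) (A := D * |t - s|)
      (B := 2 * C) (C := 2 * C) (h := w) (by positivity) hw0 ((d1 t ht).sub (d1 s hs))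
      (by rw [hsub]; exact (d2 t ht).sub (d2 s hs)) (hD s hs t ht)
      (fun x => by
        rw [hsub]
        exact (norm_sub_le _ _).trans (by linarith [b1 t ht x, b1 s hs x]))
      (fun x => by
        rw [hsub, hsub2]
        exact (norm_sub_le _ _).trans (by linarith [b2 t ht x, b2 s hs x]))
      (fun x y => by
        rw [hsub, hsub2, hsub2]
        have e : ∀ a b c d : E →L[ℝ] E →L[ℝ] W →L[ℝ] E, a - b - (c - d) = (a - c) - (b - d) :=
          fun a b c d => by abel
        rw [e]
        refine (norm_sub_le _ _).trans ?_
        linarith [lip t ht x y, lip s hs x y]) x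
    rw [hsub, hsub2, hw3] at this
    rw [hw2]
    have e1 : 4 * (D * w ^ 3) / w + 8 * (2 * C) * w ^ 2 = (4 * D + 16 * C) * w ^ 2 := by
      field_simp; ring
    have e2 : 2 * (D * w ^ 3) / w ^ 2 + 8 * (2 * C) * w = (2 * D + 16 * C) * w := by
      field_simp; ring
    rw [e1, e2] at this
    refine ⟨this.1, this.2.trans ?_⟩
    gcongr
    linarith
  refine ⟨K + (4 * D + 16 * C), ⟨by positivity, d1, fun t ht x => ?_, fun t ht x => ?_,
    fun t ht x y => ?_, fun s hs t ht x => ?_, fun s hs t ht x => ?_⟩, d2, fun t ht x => ?_,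
    fun t ht x y => ?_, fun s hs t ht x => ?_, fun s hs t ht x => ?_⟩
  · exact (hK.norm_le t ht x).trans (by linarith)
  · exact (hK.fderiv_le t ht x).trans (by linarith)
  · exact (hK.fderiv_lip t ht x y).trans (mul_le_mul_of_nonneg_right (by linarith) (norm_nonneg _))
  · exact (hK.time_lip s hs t ht x).trans (mul_le_mul_of_nonneg_right (by linarith) (by positivity))
  · exact (hK.fderiv_time s hs t ht x).trans (mul_le_mul_of_nonneg_right (by linarith) (by positivity))
  · exact (b2 t ht x).trans (by linarith)
  · exact (lip t ht x y).trans (by gcongr; linarith)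
  · exact (time s hs t ht x).1.trans (mul_le_mul_of_nonneg_right (by linarith) (by positivity))
  · exact (time s hs t ht x).2.trans (mul_le_mul_of_nonneg_right (by linarith) (by positivity))

end Coefficients

/-! ### The field `∇σ σ` and the increments of the coefficients -/

section SecondField

variable {E W : Type*} [NormedAddCommGroup E] [NormedSpace ℝ E]
  [NormedAddCommGroup W] [NormedSpace ℝ W] {T K : ℝ} {σ : ℝ → E → W →L[ℝ] E}

/-- The field `∇σ σ`, whose first argument is the direction of differentiation. -/
noncomputable def secondField (σ : ℝ → E → W →L[ℝ] E) (s : ℝ) (x : E) : W →L[ℝ] W →L[ℝ] E :=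
  (fderiv ℝ (σ s) x).comp (σ s x)

lemma CoeffBound.norm_secondField_le (h : CoeffBound T K σ) {s : ℝ} (hs : s ∈ Icc 0 T) (x : E) :
    ‖secondField σ s x‖ ≤ K ^ 2 := by
  refine (ContinuousLinearMap.opNorm_comp_le _ _).trans ?_
  rw [sq]
  exact mul_le_mul (h.fderiv_le s hs x) (h.norm_le s hs x) (norm_nonneg _) h.nonneg

lemma CoeffBound.norm_sub_le (h : CoeffBound T K σ) {s u : ℝ} (hs : s ∈ Icc 0 T)
    (hu : u ∈ Icc 0 T) (a c : E) : ‖σ u c - σ s a‖ ≤ K * |u - s| + K * ‖c - a‖ := by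
  have e : σ u c - σ s a = (σ u c - σ s c) + (σ s c - σ s a) := by abel
  rw [e]
  exact (norm_add_le _ _).trans (add_le_add (h.time_lip s hs u hu c)
    (norm_sub_le_of_norm_fderiv_le (h.differentiable s hs) (h.fderiv_le s hs) a c))

/-- Chain rule for controlled paths: the remainder splits into a time increment, a Taylor remainder
in space, and `∇σ` applied to the remainder of the path. -/
lemma CoeffBound.norm_remainder_le (h : CoeffBound T K σ) {s u : ℝ} (hs : s ∈ Icc 0 T)
    (hu : u ∈ Icc 0 T) (a c : E) (w : W) :
    ‖σ u c - σ s a - secondField σ s a w‖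
      ≤ K * |u - s| + K * ‖c - a‖ ^ 2 + K * ‖c - a - σ s a w‖ := by
  have e : σ u c - σ s a - secondField σ s a w = (σ u c - σ s c)
      + (σ s c - σ s a - fderiv ℝ (σ s) a (c - a)) + fderiv ℝ (σ s) a (c - a - σ s a w) := by
    simp only [secondField, ContinuousLinearMap.comp_apply, map_sub]; abel
  rw [e]
  exact norm_add₃_le.trans (add_le_add (add_le_add (h.time_lip s hs u hu c)
    (norm_taylor_one_le h.nonneg (h.differentiable s hs) (h.fderiv_lip s hs) a c))
    (ContinuousLinearMap.le_of_opNorm_le _ (h.fderiv_le s hs a) _))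

lemma CoeffBound.norm_secondField_sub_le (h : CoeffBound T K σ) {s u : ℝ} (hs : s ∈ Icc 0 T)
    (hu : u ∈ Icc 0 T) (a c : E) :
    ‖secondField σ u c - secondField σ s a‖
      ≤ K ^ 2 * (|u - s| ^ (1 / 2 : ℝ) + |u - s| + 2 * ‖c - a‖) := by
  have hK := h.nonneg
  have e : secondField σ u c - secondField σ s a
      = (fderiv ℝ (σ u) c - fderiv ℝ (σ s) a).comp (σ u c)
        + (fderiv ℝ (σ s) a).comp (σ u c - σ s a) := by
    simp only [secondField, ContinuousLinearMap.sub_comp, ContinuousLinearMap.comp_sub]; abel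
  have e' : fderiv ℝ (σ u) c - fderiv ℝ (σ s) a = (fderiv ℝ (σ u) c - fderiv ℝ (σ s) c)
      + (fderiv ℝ (σ s) c - fderiv ℝ (σ s) a) := by abel
  have h1 : ‖fderiv ℝ (σ u) c - fderiv ℝ (σ s) a‖
      ≤ K * |u - s| ^ (1 / 2 : ℝ) + K * ‖c - a‖ := by
    rw [e']
    exact (norm_add_le _ _).trans (add_le_add (h.fderiv_time s hs u hu c)
      (h.fderiv_lip s hs a c))
  rw [e]
  refine (norm_add_le _ _).trans ?_
  calc _ ≤ ‖fderiv ℝ (σ u) c - fderiv ℝ (σ s) a‖ * ‖σ u c‖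
        + ‖fderiv ℝ (σ s) a‖ * ‖σ u c - σ s a‖ :=
        add_le_add (ContinuousLinearMap.opNorm_comp_le _ _)
          (ContinuousLinearMap.opNorm_comp_le _ _)
    _ ≤ (K * |u - s| ^ (1 / 2 : ℝ) + K * ‖c - a‖) * K + K * (K * |u - s| + K * ‖c - a‖) := by
        gcongr
        · exact h.norm_le u hu c
        · exact h.fderiv_le s hs a
        · exact h.norm_sub_le hs hu a c
    _ = _ := by ring

end SecondField

/-! ### Estimates over a single step -/

section Local

variable {d : ℕ} {E : Type*} [NormedAddCommGroup E] [NormedSpace ℝ E] {T κ K Z B : ℝ}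
  {σ : ℝ → E → Euc d →L[ℝ] E} {ζ : ℝ → Euc d} {ζ2 : ℝ → ℝ → Fin d → Fin d → ℝ}

/-- Hölder bounds with exponent `κ` for a rough path. -/
structure RoughBound (T κ Z : ℝ) (ζ : ℝ → Euc d) (ζ2 : ℝ → ℝ → Fin d → Fin d → ℝ) : Prop where
  nonneg : 0 ≤ Z
  path : ∀ s t, 0 ≤ s → s ≤ t → t ≤ T → ‖incr ζ s t‖ ≤ Z * (t - s) ^ κ
  area : ∀ s t, 0 ≤ s → s ≤ t → t ≤ T → (d : ℝ) ^ 2 * ‖ζ2 s t‖ ≤ Z * (t - s) ^ (2 * κ)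

lemma IsGeometricRoughPath.exists_roughBound {α : ℝ} (h : IsGeometricRoughPath T α ζ ζ2)
    (hκ : 0 < κ) (hκα : κ ≤ α) : ∃ Z, RoughBound T κ Z ζ ζ2 := by
  obtain ⟨C, hC0, hC⟩ := (Holder₂.mono h.holder_path hκ hκα).exists_nonneg
  obtain ⟨D, hD0, hD⟩ := (h.holder_area.mono (q := 2 * κ) (by linarith)
    (by linarith)).exists_nonneg
  refine ⟨C + (d : ℝ) ^ 2 * D, by positivity, fun s t hs hst ht => ?_, fun s t hs hst ht => ?_⟩
  · refine (hC s t hs hst ht).trans (mul_le_mul_of_nonneg_right ?_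
      (Real.rpow_nonneg (by linarith) _))
    have : 0 ≤ (d : ℝ) ^ 2 * D := by positivity
    linarith
  · calc (d : ℝ) ^ 2 * ‖ζ2 s t‖ ≤ (d : ℝ) ^ 2 * (D * (t - s) ^ (2 * κ)) := by
          gcongr; exact hD s t hs hst ht
      _ = (d : ℝ) ^ 2 * D * (t - s) ^ (2 * κ) := by ring
      _ ≤ _ := mul_le_mul_of_nonneg_right (by linarith) (Real.rpow_nonneg (by linarith) _)

lemma RoughBound.norm_areaTerm_le (h : RoughBound T κ Z ζ ζ2) {s t : ℝ} (hs : 0 ≤ s)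
    (hst : s ≤ t) (ht : t ≤ T) (A : Euc d →L[ℝ] Euc d →L[ℝ] E) :
    ‖areaTerm A (ζ2 s t)‖ ≤ ‖A‖ * (Z * (t - s) ^ (2 * κ)) :=
  (RoughDE.norm_areaTerm_le A _).trans
    (mul_le_mul_of_nonneg_left (h.area s t hs hst ht) (norm_nonneg _))

lemma rpow_le_rpow_of_le_one {l p q : ℝ} (hl : 0 ≤ l) (hl1 : l ≤ 1) (hq : 0 ≤ q) (hqp : q ≤ p) :
    l ^ p ≤ l ^ q :=
  Real.rpow_le_rpow_of_exponent_ge' hl hl1 hq hqp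

/-- Hölder constant of a path with a local expansion along `σ`. -/
noncomputable def pathConst (B K Z : ℝ) : ℝ := B + K * Z + K ^ 2 * Z + 1

/-- The constant in the bound of the defect of additivity of the local expansion. -/
noncomputable def defectConst (B K Z : ℝ) : ℝ :=
  Z * (K * (1 + pathConst B K Z ^ 2 + pathConst B K Z) + K ^ 2 * (2 + 2 * pathConst B K Z))

/-- Estimates for one step from `(s, a)` to `(u, c)` with drift `v` along the local expansion. -/
structure StepBound (K κ N s u : ℝ) (σ : ℝ → E → Euc d →L[ℝ] E) (ζ : ℝ → Euc d) (a c : E) :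
    Prop where
  path : ‖c - a‖ ≤ N * (u - s) ^ κ
  path_remainder : ‖c - a - σ s a (incr ζ s u)‖ ≤ N * (u - s) ^ (2 * κ)
  coeff : ‖σ u c - σ s a‖ ≤ K * (1 + N) * (u - s) ^ κ
  coeff_remainder : ‖σ u c - σ s a - secondField σ s a (incr ζ s u)‖
    ≤ K * (1 + N ^ 2 + N) * (u - s) ^ (2 * κ)
  second : ‖secondField σ u c - secondField σ s a‖ ≤ K ^ 2 * (2 + 2 * N) * (u - s) ^ κ

/-- The expansion error is assumed only of order `2κ` with constant one. The resulting constants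
depend on `B`, `K`, `Z` alone and not on the constant of the `3κ` bound, so the induction in
`euler_expansion` does not degrade them. -/
lemma stepBound_of_expansion (hσ : CoeffBound T K σ) (hR : RoughBound T κ Z ζ ζ2)
    (hκ : 1 / 3 < κ) (hκ2 : κ ≤ 1 / 2) (hB : 0 ≤ B) {s u : ℝ} (hs : 0 ≤ s) (hsu : s ≤ u)
    (hu : u ≤ T) (h1 : u - s ≤ 1) {a c v : E} (hv : ‖v‖ ≤ B * (u - s))
    (hJ : ‖c - a - v - (σ s a (incr ζ s u) + areaTerm (secondField σ s a) (ζ2 s u))‖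
      ≤ (u - s) ^ (2 * κ)) :
    StepBound K κ (pathConst B K Z) s u σ ζ a c := by
  have hK := hσ.nonneg
  have hZ := hR.nonneg
  have sI : s ∈ Icc 0 T := ⟨hs, by linarith⟩
  have uI : u ∈ Icc 0 T := ⟨by linarith, hu⟩
  have w0 : 0 ≤ u - s := by linarith
  have p1 : u - s ≤ (u - s) ^ (2 * κ) := by
    simpa using rpow_le_rpow_of_le_one (p := 1) w0 h1 (by linarith) (by linarith : 2 * κ ≤ 1)
  have p2 : (u - s) ^ (2 * κ) ≤ (u - s) ^ κ :=
    rpow_le_rpow_of_le_one w0 h1 (by linarith) (by linarith)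
  have p3 : (u - s) ^ (1 / 2 : ℝ) ≤ (u - s) ^ κ :=
    rpow_le_rpow_of_le_one w0 h1 (by linarith) hκ2
  have p4 : ((u - s) ^ κ) ^ 2 = (u - s) ^ (2 * κ) := by
    rw [← Real.rpow_mul_natCast w0, mul_comm]; norm_num
  have q0 : 0 ≤ (u - s) ^ κ := Real.rpow_nonneg w0 _
  have q1 : 0 ≤ (u - s) ^ (2 * κ) := Real.rpow_nonneg w0 _
  have hN0 : 0 ≤ pathConst B K Z := by unfold pathConst; positivity
  have hA : ‖areaTerm (secondField σ s a) (ζ2 s u)‖ ≤ K ^ 2 * Z * (u - s) ^ (2 * κ) := by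
    refine (hR.norm_areaTerm_le hs hsu hu _).trans ?_
    rw [mul_assoc]
    exact mul_le_mul_of_nonneg_right (hσ.norm_secondField_le sI a) (by positivity)
  have hS : ‖σ s a (incr ζ s u)‖ ≤ K * Z * (u - s) ^ κ := by
    refine (ContinuousLinearMap.le_of_opNorm_le _ (hσ.norm_le s sI a) _).trans ?_
    rw [mul_assoc]
    exact mul_le_mul_of_nonneg_left (hR.path s u hs hsu hu) hK
  have e2 : c - a - σ s a (incr ζ s u)
      = (c - a - v - (σ s a (incr ζ s u) + areaTerm (secondField σ s a) (ζ2 s u)))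
        + v + areaTerm (secondField σ s a) (ζ2 s u) := by abel
  have r2' : ‖c - a - σ s a (incr ζ s u)‖ ≤ (B + K ^ 2 * Z + 1) * (u - s) ^ (2 * κ) := by
    rw [e2]
    refine norm_add₃_le.trans ?_
    have := mul_le_mul_of_nonneg_left p1 hB
    linarith
  have r2 : ‖c - a - σ s a (incr ζ s u)‖ ≤ pathConst B K Z * (u - s) ^ (2 * κ) := by
    refine r2'.trans (mul_le_mul_of_nonneg_right ?_ q1)
    unfold pathConst
    nlinarith [mul_nonneg hK hZ]
  have r1 : ‖c - a‖ ≤ pathConst B K Z * (u - s) ^ κ := by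
    have e : c - a = (c - a - σ s a (incr ζ s u)) + σ s a (incr ζ s u) := by abel
    rw [e]
    refine (norm_add_le _ _).trans ((add_le_add r2' hS).trans ?_)
    have : (B + K ^ 2 * Z + 1) * (u - s) ^ (2 * κ) ≤ (B + K ^ 2 * Z + 1) * (u - s) ^ κ :=
      mul_le_mul_of_nonneg_left p2 (by positivity)
    unfold pathConst
    linarith
  have r1s : ‖c - a‖ ^ 2 ≤ pathConst B K Z ^ 2 * (u - s) ^ (2 * κ) := by
    rw [← p4, ← mul_pow]
    exact pow_le_pow_left₀ (norm_nonneg _) r1 2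
  have habs : |u - s| = u - s := abs_of_nonneg w0
  refine ⟨r1, r2, ?_, ?_, ?_⟩
  · refine (hσ.norm_sub_le sI uI a c).trans ?_
    rw [habs]
    have := mul_le_mul_of_nonneg_left (p1.trans p2) hK
    have := mul_le_mul_of_nonneg_left r1 hK
    linarith
  · refine (hσ.norm_remainder_le sI uI a c _).trans ?_
    rw [habs]
    have := mul_le_mul_of_nonneg_left p1 hK
    have := mul_le_mul_of_nonneg_left r1s hK
    have := mul_le_mul_of_nonneg_left r2 hK
    linarith
  · refine (hσ.norm_secondField_sub_le sI uI a c).trans ?_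
    rw [habs, mul_assoc]
    refine mul_le_mul_of_nonneg_left ?_ (by positivity)
    linarith

/-- The two terms have orders `2κ + κ` and `κ + 2κ`. -/
lemma StepBound.norm_defect_le {N : ℝ} (hS : StepBound K κ N s u σ ζ a c) (hK : 0 ≤ K)
    (hN : 0 ≤ N) (hR : RoughBound T κ Z ζ ζ2) (hκ : 0 ≤ κ) {t : ℝ} (hs : 0 ≤ s) (hsu : s ≤ u)
    (hut : u ≤ t) (ht : t ≤ T) :
    ‖(σ u c - σ s a - secondField σ s a (incr ζ s u)) (incr ζ u t)
        + areaTerm (secondField σ u c - secondField σ s a) (ζ2 u t)‖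
      ≤ Z * (K * (1 + N ^ 2 + N) + K ^ 2 * (2 + 2 * N)) * (t - s) ^ (3 * κ) := by
  have hZ := hR.nonneg
  have hl : 0 ≤ t - s := by linarith
  have m1 : ∀ p : ℝ, 0 ≤ p → (u - s) ^ p ≤ (t - s) ^ p := fun p hp =>
    Real.rpow_le_rpow (by linarith) (by linarith) hp
  have m2 : ∀ p : ℝ, 0 ≤ p → (t - u) ^ p ≤ (t - s) ^ p := fun p hp =>
    Real.rpow_le_rpow (by linarith) (by linarith) hp
  have e3 : (t - s) ^ (2 * κ) * (t - s) ^ κ = (t - s) ^ (3 * κ) := by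
    rw [← Real.rpow_add_of_nonneg hl (by linarith) hκ]; ring_nf
  have h1 : ‖(σ u c - σ s a - secondField σ s a (incr ζ s u)) (incr ζ u t)‖
      ≤ K * (1 + N ^ 2 + N) * (t - s) ^ (2 * κ) * (Z * (t - s) ^ κ) := by
    refine (ContinuousLinearMap.le_opNorm _ _).trans ?_
    have q := Real.rpow_nonneg hl (2 * κ)
    have hp := hR.path u t (by linarith) hut ht
    refine mul_le_mul (hS.coeff_remainder.trans ?_) (hp.trans ?_) (norm_nonneg _) (by positivity)
    · exact mul_le_mul_of_nonneg_left (m1 _ (by linarith)) (by positivity)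
    · exact mul_le_mul_of_nonneg_left (m2 _ hκ) hZ
  have h2 : ‖areaTerm (secondField σ u c - secondField σ s a) (ζ2 u t)‖
      ≤ K ^ 2 * (2 + 2 * N) * (t - s) ^ κ * (Z * (t - s) ^ (2 * κ)) := by
    refine (hR.norm_areaTerm_le (by linarith) hut ht _).trans ?_
    have q := Real.rpow_nonneg hl κ
    refine mul_le_mul (hS.second.trans ?_) ?_
      (mul_nonneg hZ (Real.rpow_nonneg (by linarith) _)) (by positivity)
    · exact mul_le_mul_of_nonneg_left (m1 _ hκ) (by positivity)
    · exact mul_le_mul_of_nonneg_left (m2 _ (by linarith)) hZ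
  refine (norm_add_le _ _).trans ((add_le_add h1 h2).trans (le_of_eq ?_))
  rw [← e3]
  ring

end Local

/-! ### The Euler scheme and its uniform expansion -/

section Euler

variable {d : ℕ} {E : Type*} [NormedAddCommGroup E] [NormedSpace ℝ E]

/-- The accumulated drift `D` is kept apart from `X`, as the discrete counterpart of `∫ b`; only in
the limit is it identified with that integral. -/
lemma exists_euler_scheme (τ : ℕ → ℝ) (b : ℝ → E → E) (σ : ℝ → E → Euc d →L[ℝ] E)
    (ζ : ℝ → Euc d) (ζ2 : ℝ → ℝ → Fin d → Fin d → ℝ) (y : E) :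
    ∃ X D : ℕ → E, X 0 = y ∧ D 0 = 0 ∧
      (∀ k, D (k + 1) = D k + (τ (k + 1) - τ k) • b (τ k) (X k)) ∧
      ∀ k, X (k + 1) - X k = (D (k + 1) - D k) + (σ (τ k) (X k) (incr ζ (τ k) (τ (k + 1)))
        + areaTerm (secondField σ (τ k) (X k)) (ζ2 (τ k) (τ (k + 1)))) := by
  let X : ℕ → E := fun n => Nat.rec y (fun k x => x + ((τ (k + 1) - τ k) • b (τ k) x
    + (σ (τ k) x (incr ζ (τ k) (τ (k + 1)))
      + areaTerm (secondField σ (τ k) x) (ζ2 (τ k) (τ (k + 1)))))) n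
  refine ⟨X, fun n => ∑ k ∈ Finset.range n, (τ (k + 1) - τ k) • b (τ k) (X k), rfl, by simp,
    fun k => Finset.sum_range_succ _ _, fun k => ?_⟩
  have hX : X (k + 1) - X k = (τ (k + 1) - τ k) • b (τ k) (X k)
      + (σ (τ k) (X k) (incr ζ (τ k) (τ (k + 1)))
        + areaTerm (secondField σ (τ k) (X k)) (ζ2 (τ k) (τ (k + 1)))) :=
    add_sub_cancel_left (X k) _
  rw [hX]
  beta_reduce
  rw [Finset.sum_range_succ, add_sub_cancel_left]

lemma norm_euler_drift_sub_le {τ : ℕ → ℝ} (hτ : Monotone τ) {b : ℝ → E → E} {X D : ℕ → E}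
    (hD : ∀ k, D (k + 1) = D k + (τ (k + 1) - τ k) • b (τ k) (X k)) {i j : ℕ} (hij : i ≤ j)
    {v : E} {η : ℝ} (hv : ∀ k, i ≤ k → k < j → ‖b (τ k) (X k) - v‖ ≤ η) :
    ‖D j - D i - (τ j - τ i) • v‖ ≤ η * (τ j - τ i) := by
  induction j, hij using Nat.le_induction with
  | base => simp
  | succ j hij ih =>
    have h1 := ih fun k hk hkj => hv k hk (by omega)
    have h2 := hv j hij (Nat.lt_succ_self j)
    have hm : 0 ≤ τ (j + 1) - τ j := sub_nonneg.2 (hτ (Nat.le_succ j))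
    have e : D (j + 1) - D i - (τ (j + 1) - τ i) • v
        = (D j - D i - (τ j - τ i) • v) + (τ (j + 1) - τ j) • (b (τ j) (X j) - v) := by
      rw [hD]; module
    rw [e]
    refine (norm_add_le _ _).trans ?_
    rw [norm_smul, Real.norm_of_nonneg hm]
    nlinarith

/-- Discrete sewing applied to the expansion error. Its defect is estimated by
`StepBound.norm_defect_le`, whose step bounds follow from the error estimate on the left
subinterval. -/
lemma euler_expansion {T α κ K Z B ε : ℝ} {b : ℝ → E → E} {σ : ℝ → E → Euc d →L[ℝ] E}
    {ζ : ℝ → Euc d} {ζ2 : ℝ → ℝ → Fin d → Fin d → ℝ} (hζ : IsGeometricRoughPath T α ζ ζ2)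
    (hσ : CoeffBound T K σ) (hR : RoughBound T κ Z ζ ζ2) (hκ : 1 / 3 < κ) (hκ2 : κ ≤ 1 / 2)
    (hB : ∀ t ∈ Icc 0 T, ∀ x, ‖b t x‖ ≤ B) (hε1 : ε ≤ 1)
    (hε : 2 * defectConst B K Z / (1 - 2 ^ (1 - 3 * κ)) * ε ^ κ ≤ 1)
    {τ : ℕ → ℝ} (hτ : Monotone τ) (hτT : ∀ k, τ k ∈ Icc 0 T) {X D : ℕ → E}
    (hD : ∀ k, D (k + 1) = D k + (τ (k + 1) - τ k) • b (τ k) (X k))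
    (hX : ∀ k, X (k + 1) - X k = (D (k + 1) - D k) + (σ (τ k) (X k) (incr ζ (τ k) (τ (k + 1)))
        + areaTerm (secondField σ (τ k) (X k)) (ζ2 (τ k) (τ (k + 1)))))
    {i j : ℕ} (hij : i ≤ j) (hl : τ j - τ i ≤ ε) :
    ‖X j - X i - (D j - D i) - (σ (τ i) (X i) (incr ζ (τ i) (τ j))
        + areaTerm (secondField σ (τ i) (X i)) (ζ2 (τ i) (τ j)))‖
      ≤ 2 * defectConst B K Z / (1 - 2 ^ (1 - 3 * κ)) * (τ j - τ i) ^ (3 * κ) := by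
  have hK := hσ.nonneg
  have hZ := hR.nonneg
  have hB0 : 0 ≤ B := (norm_nonneg _).trans (hB _ (hτT 0) (X 0))
  have hN0 : 0 ≤ pathConst B K Z := by unfold pathConst; positivity
  have hA0 : 0 ≤ defectConst B K Z := by unfold defectConst; positivity
  have hL0 : 0 ≤ 2 * defectConst B K Z / (1 - 2 ^ (1 - 3 * κ)) :=
    div_nonneg (by linarith) (by linarith [two_rpow_one_sub_lt_one (θ := 3 * κ) (by linarith)])
  refine discrete_sewing hτ (ε := ε) (J := fun i j => X j - X i - (D j - D i)
    - (σ (τ i) (X i) (incr ζ (τ i) (τ j))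
      + areaTerm (secondField σ (τ i) (X i)) (ζ2 (τ i) (τ j)))) (by linarith) (fun i => ?_)
    (fun i => ?_) (fun i k j hik hkj hle hJ => ?_) hA0 hij hl
  · have h0 : areaTerm (secondField σ (τ i) (X i)) (ζ2 (τ i) (τ i)) = 0 := by
      have := hR.norm_areaTerm_le (hτT i).1 le_rfl (hτT i).2 (secondField σ (τ i) (X i))
      rw [sub_self, Real.zero_rpow (by linarith), mul_zero, mul_zero] at this
      exact norm_le_zero_iff.1 this
    simp [h0, incr]
  · simp only [hX]; abel
  · have mik := hτ hik
    have mkj := hτ hkj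
    have w0 : 0 ≤ τ k - τ i := sub_nonneg.2 mik
    have hv : ‖D k - D i‖ ≤ B * (τ k - τ i) := by
      simpa using norm_euler_drift_sub_le hτ hD hik (v := 0) (η := B)
        fun n _ _ => by simpa using hB _ (hτT n) (X n)
    -- Here the loop closes: the smallness of `ε` absorbs the sewing constant into a factor `(τ k -
    -- τ i) ^ κ`, leaving order `2κ` with constant one.
    have hJ' := hJ.trans (show _ ≤ (τ k - τ i) ^ (2 * κ) by
      have e : (τ k - τ i) ^ (3 * κ) = (τ k - τ i) ^ κ * (τ k - τ i) ^ (2 * κ) := by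
        rw [← Real.rpow_add_of_nonneg w0 (by linarith) (by linarith)]; ring_nf
      rw [e, ← mul_assoc]
      refine mul_le_of_le_one_left (Real.rpow_nonneg w0 _) (le_trans ?_ hε)
      exact mul_le_mul_of_nonneg_left
        (Real.rpow_le_rpow w0 (by linarith) (by linarith)) hL0)
    have hS := stepBound_of_expansion hσ hR hκ hκ2 hB0 (hτT i).1 mik (hτT k).2
      (by linarith) hv hJ'
    have hdef := hS.norm_defect_le hK hN0 hR (by linarith) (hτT i).1 mik mkj (hτT j).2
    have hg := germ_delta hζ (hτT i).1 mik mkj (hτT j).2 (σ (τ i) (X i)) (σ (τ k) (X k))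
      (secondField σ (τ i) (X i)) (secondField σ (τ k) (X k))
    rw [← hg] at hdef
    refine le_trans (le_of_eq ?_) hdef
    congr 1
    abel

end Euler

/-! ### From local to global bounds; finite sets of times -/

open Filter Topology

lemma Holder₂.of_local {V : Type*} [NormedAddCommGroup V] {T p ε C M : ℝ} {f : ℝ → ℝ → V}
    (hε : 0 < ε) (hp : 0 ≤ p)
    (h : ∀ s t, 0 ≤ s → s ≤ t → t ≤ T → t - s ≤ ε → ‖f s t‖ ≤ C * (t - s) ^ p)
    (hM : ∀ s t, 0 ≤ s → s ≤ t → t ≤ T → ‖f s t‖ ≤ M) : Holder₂ T p f := by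
  refine ⟨max C (M / ε ^ p), fun s t hs hst ht => ?_⟩
  have hl : 0 ≤ (t - s) ^ p := Real.rpow_nonneg (by linarith) _
  rcases le_or_gt (t - s) ε with hle | hlt
  · exact (h s t hs hst ht hle).trans (mul_le_mul_of_nonneg_right (le_max_left _ _) hl)
  · refine le_trans ?_ (mul_le_mul_of_nonneg_right (le_max_right _ _) hl)
    have hεp : 0 < ε ^ p := Real.rpow_pos_of_pos hε _
    have h1 : ε ^ p ≤ (t - s) ^ p := Real.rpow_le_rpow hε.le hlt.le hp
    have h2 := hM s t hs hst ht
    rw [div_mul_eq_mul_div, le_div_iff₀ hεp]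
    exact mul_le_mul h2 h1 hεp.le ((norm_nonneg _).trans h2)

lemma exists_enumeration (Q : Finset ℝ) {T : ℝ} (hQ : ∀ t ∈ Q, t ∈ Icc 0 T) (h0 : 0 ∈ Q) :
    ∃ (τ : ℕ → ℝ) (idx : ℝ → ℕ), Monotone τ ∧ (∀ k, τ k ∈ Q) ∧ (∀ t ∈ Q, τ (idx t) = t) ∧
      idx 0 = 0 ∧ (∀ s ∈ Q, ∀ t ∈ Q, s ≤ t → idx s ≤ idx t) ∧
      ∀ t ∈ Q, ∀ k ≤ idx t, idx (τ k) = k := by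
  classical
  have hpos : 0 < Q.card := Finset.card_pos.2 ⟨0, h0⟩
  let e := Q.orderIsoOfFin rfl
  -- The index is capped at the last point of `Q`, so the sequence is constant from there on; this
  -- is why `idx (τ k) = k` is asserted only for `k ≤ idx t`.
  let p : ℕ → Fin Q.card := fun k => ⟨min k (Q.card - 1), by omega⟩
  have hidx : ∀ t (h : t ∈ Q), (if h : t ∈ Q then ((e.symm ⟨t, h⟩ : Fin Q.card) : ℕ) else 0)
      = (e.symm ⟨t, h⟩ : Fin Q.card) := fun t h => dif_pos h
  have hτidx : ∀ t (h : t ∈ Q), p (e.symm ⟨t, h⟩ : Fin Q.card) = e.symm ⟨t, h⟩ := fun t h => by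
    have := (e.symm ⟨t, h⟩).isLt
    ext
    simp only [p]
    omega
  have hp : Monotone p := fun i j hij => by
    simp only [p, Fin.mk_le_mk]; omega
  have hmono : Monotone fun k => (e (p k) : ℝ) := fun i j hij => e.monotone (hp hij)
  have hidxτ : ∀ k, (if h : (e (p k) : ℝ) ∈ Q then ((e.symm ⟨e (p k), h⟩ : Fin Q.card) : ℕ) else 0)
      = min k (Q.card - 1) := fun k => by
    rw [hidx _ (e (p k)).2]
    simp [p]
  have hzero : (e (p 0) : ℝ) = 0 := by
    refine le_antisymm ?_ (hQ _ (e (p 0)).2).1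
    have := hmono (Nat.zero_le (e.symm ⟨0, h0⟩ : Fin Q.card))
    simpa only [hτidx 0 h0, OrderIso.apply_symm_apply] using this
  refine ⟨fun k => e (p k), fun t => if h : t ∈ Q then (e.symm ⟨t, h⟩ : Fin Q.card) else 0,
    hmono, fun k => (e (p k)).2, fun t ht => ?_, ?_, fun s hs t ht hst => ?_,
    fun t ht k hk => ?_⟩
  · simp only [hidx t ht, hτidx t ht, OrderIso.apply_symm_apply]
  · have := hidxτ 0
    rw [hzero] at this
    simpa using this
  · simp only [hidx s hs, hidx t ht]
    exact_mod_cast e.symm.monotone (show (⟨s, hs⟩ : Q) ≤ ⟨t, ht⟩ from hst)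
  · simp only [hidx t ht] at hk
    have := (e.symm ⟨t, ht⟩).isLt
    exact (hidxτ k).trans (by omega)

/-- A path on `Q` with bounded increments over distance `ε` is bounded if `Q` contains a net. -/
lemma norm_le_of_net {E : Type*} [NormedAddCommGroup E] {Q : Finset ℝ} {x : ℝ → E} {T N ε : ℝ} (hN : 0 ≤ N)
    (hQ : ∀ t ∈ Q, t ∈ Icc 0 T) (hε : 0 < ε) {M : ℕ} (hM : T ≤ M * ε)
    (hnet : ∀ k : ℕ, k * ε ≤ T → k * ε ∈ Q)
    (hx : ∀ s ∈ Q, ∀ t ∈ Q, s ≤ t → t - s ≤ ε → ‖x t - x s‖ ≤ N) {t : ℝ} (ht : t ∈ Q) :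
    ‖x t‖ ≤ ‖x 0‖ + (M + 1) * N := by
  have h1 : ∀ k : ℕ, k * ε ≤ T → ‖x (k * ε)‖ ≤ ‖x 0‖ + k * N := by
    intro k
    induction k with
    | zero => intro _; simp
    | succ k ih =>
      intro hk
      have hk' : (k : ℝ) * ε ≤ ((k + 1 : ℕ) : ℝ) * ε := by push_cast; nlinarith
      have h2 := ih (hk'.trans hk)
      have h3 := hx _ (hnet k (hk'.trans hk)) _ (hnet (k + 1) hk) hk' (by push_cast; linarith)
      have h4 := norm_le_norm_add_norm_sub' (x (((k + 1 : ℕ) : ℝ) * ε)) (x (k * ε))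
      push_cast at h3 h4 ⊢
      linarith
  obtain ⟨ht0, htT⟩ := hQ t ht
  set k := ⌊t / ε⌋₊ with hk
  have hk1 : (k : ℝ) * ε ≤ t := by
    rw [← le_div_iff₀ hε]; exact Nat.floor_le (div_nonneg ht0 hε.le)
  have hk2 : t < (k + 1 : ℝ) * ε := by
    rw [← div_lt_iff₀ hε]; exact Nat.lt_floor_add_one _
  have hkM : (k : ℝ) ≤ M := by
    have : (k : ℝ) * ε ≤ M * ε := (hk1.trans htT).trans hM
    exact le_of_mul_le_mul_right this hε
  have h2 := h1 k (hk1.trans htT)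
  have h3 := hx _ (hnet k (hk1.trans htT)) t ht hk1 (by linarith)
  have h4 := norm_le_norm_add_norm_sub' (x t) (x (k * ε))
  have h5 : (k : ℝ) * N ≤ M * N := mul_le_mul_of_nonneg_right hkM hN
  linarith

/-! ### Compactness: the limit of Euler paths -/

section Existence

variable {d : ℕ} {E : Type*} [NormedAddCommGroup E] [NormedSpace ℝ E]

/-- An Euler path with drift `D` along the finite set `Q`, with a uniform local expansion. -/
structure IsEulerPath (κ L ε : ℝ) (ζ : ℝ → Euc d) (ζ2 : ℝ → ℝ → Fin d → Fin d → ℝ)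
    (b : ℝ → E → E) (σ : ℝ → E → Euc d →L[ℝ] E) (y : E) (Q : Finset ℝ) (x D : ℝ → E) : Prop where
  initial : x 0 = y
  drift_initial : D 0 = 0
  expansion : ∀ s ∈ Q, ∀ t ∈ Q, s ≤ t → t - s ≤ ε →
    ‖x t - x s - (D t - D s) - (σ s (x s) (incr ζ s t) + areaTerm (secondField σ s (x s)) (ζ2 s t))‖
      ≤ L * (t - s) ^ (3 * κ)
  drift : ∀ s ∈ Q, ∀ t ∈ Q, s ≤ t → ∀ (v : E) (η : ℝ),
    (∀ u ∈ Q, s ≤ u → u ≤ t → ‖b u (x u) - v‖ ≤ η) → ‖D t - D s - (t - s) • v‖ ≤ η * (t - s)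

variable {T α κ K Z B ε L : ℝ} {b : ℝ → E → E} {σ : ℝ → E → Euc d →L[ℝ] E}
  {ζ : ℝ → Euc d} {ζ2 : ℝ → ℝ → Fin d → Fin d → ℝ} {y : E}

lemma exists_isEulerPath (hζ : IsGeometricRoughPath T α ζ ζ2)
    (hσ : CoeffBound T K σ) (hR : RoughBound T κ Z ζ ζ2) (hκ : 1 / 3 < κ) (hκ2 : κ ≤ 1 / 2)
    (hB : ∀ t ∈ Icc 0 T, ∀ x, ‖b t x‖ ≤ B) (hε1 : ε ≤ 1)
    (hL : L = 2 * defectConst B K Z / (1 - 2 ^ (1 - 3 * κ))) (hε : L * ε ^ κ ≤ 1) (y : E)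
    (Q : Finset ℝ) (hQ : ∀ t ∈ Q, t ∈ Icc 0 T) (h0 : 0 ∈ Q) :
    ∃ x D : ℝ → E, IsEulerPath κ L ε ζ ζ2 b σ y Q x D := by
  obtain ⟨τ, idx, hτ, hτQ, hτi, hi0, him, hiτ⟩ := exists_enumeration Q hQ h0
  obtain ⟨X, D, hX0, hD0, hD, hX⟩ := exists_euler_scheme τ b σ ζ ζ2 y
  refine ⟨fun t => X (idx t), fun t => D (idx t), by simp [hi0, hX0], by simp [hi0, hD0],
    fun s hs t ht hst hle => ?_, fun s hs t ht hst v η hv => ?_⟩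
  · have := euler_expansion hζ hσ hR hκ hκ2 hB hε1 (by rwa [← hL]) hτ
      (fun k => hQ _ (hτQ k)) hD hX (him s hs t ht hst) (by rwa [hτi s hs, hτi t ht])
    rwa [hτi s hs, hτi t ht, ← hL] at this
  · have := norm_euler_drift_sub_le hτ hD (him s hs t ht hst) (v := v) (η := η)
      fun k hk hkt => by
        have h1 := hv (τ k) (hτQ k) (by rw [← hτi s hs]; exact hτ hk)
          (by rw [← hτi t ht]; exact hτ hkt.le)
        rwa [hiτ t ht k hkt.le] at h1
    rwa [hτi s hs, hτi t ht] at this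

/-- Step estimates over short times from a local expansion of order `3κ`. -/
lemma stepBound_of_isExpansion (hσ : CoeffBound T K σ) (hR : RoughBound T κ Z ζ ζ2)
    (hκ : 1 / 3 < κ) (hκ2 : κ ≤ 1 / 2) (hB : 0 ≤ B) (hL : 0 ≤ L) (hε1 : ε ≤ 1)
    (hε : L * ε ^ κ ≤ 1) {s t : ℝ} (hs : 0 ≤ s) (hst : s ≤ t) (ht : t ≤ T) (hle : t - s ≤ ε)
    {a c v : E} (hv : ‖v‖ ≤ B * (t - s))
    (h : ‖c - a - v - (σ s a (incr ζ s t) + areaTerm (secondField σ s a) (ζ2 s t))‖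
      ≤ L * (t - s) ^ (3 * κ)) : StepBound K κ (pathConst B K Z) s t σ ζ a c := by
  have w0 : 0 ≤ t - s := sub_nonneg.2 hst
  refine stepBound_of_expansion hσ hR hκ hκ2 hB hs hst ht (hle.trans hε1) hv (h.trans ?_)
  have e : (t - s) ^ (3 * κ) = (t - s) ^ κ * (t - s) ^ (2 * κ) := by
    rw [← Real.rpow_add_of_nonneg w0 (by linarith) (by linarith)]; ring_nf
  rw [e, ← mul_assoc]
  refine mul_le_of_le_one_left (Real.rpow_nonneg w0 _) (le_trans ?_ hε)
  exact mul_le_mul_of_nonneg_left (Real.rpow_le_rpow w0 hle (by linarith)) hL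

lemma IsEulerPath.norm_drift_le {Q : Finset ℝ} {x D : ℝ → E}
    (h : IsEulerPath κ L ε ζ ζ2 b σ y Q x D) (hQ : ∀ t ∈ Q, t ∈ Icc 0 T)
    (hB : ∀ t ∈ Icc 0 T, ∀ x, ‖b t x‖ ≤ B) {s t : ℝ} (hs : s ∈ Q) (ht : t ∈ Q) (hst : s ≤ t) :
    ‖D t - D s‖ ≤ B * (t - s) := by
  simpa using h.drift s hs t ht hst 0 B fun u hu _ _ => by simpa using hB u (hQ u hu) (x u)

lemma IsEulerPath.stepBound {Q : Finset ℝ} {x D : ℝ → E}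
    (h : IsEulerPath κ L ε ζ ζ2 b σ y Q x D) (hQ : ∀ t ∈ Q, t ∈ Icc 0 T)
    (hσ : CoeffBound T K σ) (hR : RoughBound T κ Z ζ ζ2) (hκ : 1 / 3 < κ) (hκ2 : κ ≤ 1 / 2)
    (hB : ∀ t ∈ Icc 0 T, ∀ x, ‖b t x‖ ≤ B) (hL : 0 ≤ L) (hε1 : ε ≤ 1) (hε : L * ε ^ κ ≤ 1)
    {s t : ℝ} (hs : s ∈ Q) (ht : t ∈ Q) (hst : s ≤ t) (hle : t - s ≤ ε) :
    StepBound K κ (pathConst B K Z) s t σ ζ (x s) (x t) :=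
  stepBound_of_isExpansion hσ hR hκ hκ2 ((norm_nonneg _).trans (hB _ (hQ s hs) (x s))) hL hε1 hε
    (hQ s hs).1 hst (hQ t ht).2 hle (h.norm_drift_le hQ hB hs ht hst)
    (h.expansion s hs t ht hst hle)

/-- The limit of Euler paths along ever finer finite sets. -/
lemma exists_limit_path [ProperSpace E] (hT : 0 < T) (hζ : IsGeometricRoughPath T α ζ ζ2)
    (hσ : CoeffBound T K σ) (hR : RoughBound T κ Z ζ ζ2) (hκ : 1 / 3 < κ) (hκ2 : κ ≤ 1 / 2)
    (hB : ∀ t ∈ Icc 0 T, ∀ x, ‖b t x‖ ≤ B)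
    (hb : ContinuousOn (fun q : ℝ × E => b q.1 q.2) (Icc 0 T ×ˢ univ)) (hε0 : 0 < ε)
    (hε1 : ε ≤ 1) (hL0 : 0 ≤ L) (hL : L = 2 * defectConst B K Z / (1 - 2 ^ (1 - 3 * κ)))
    (hε : L * ε ^ κ ≤ 1) (y : E) :
    ∃ (x D : ℝ → E) (R : ℝ), x 0 = y ∧ (∀ t ∈ Icc 0 T, ‖x t‖ ≤ R) ∧
      (∀ s t, 0 ≤ s → s ≤ t → t ≤ T → ‖D t - D s‖ ≤ B * (t - s)) ∧
      (∀ s t, 0 ≤ s → s ≤ t → t ≤ T → t - s ≤ ε →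
        ‖x t - x s - (D t - D s)
          - (σ s (x s) (incr ζ s t) + areaTerm (secondField σ s (x s)) (ζ2 s t))‖
          ≤ L * (t - s) ^ (3 * κ)) ∧
      ∀ s ∈ Ico 0 T, HasDerivWithinAt D (b s (x s)) (Ioi s) s := by
  classical
  set N := pathConst B K Z with hN
  have hB0 : 0 ≤ B := (norm_nonneg _).trans (hB 0 ⟨le_rfl, hT.le⟩ y)
  have hK := hσ.nonneg
  have hZ := hR.nonneg
  have hN0 : 0 ≤ N := by rw [hN]; unfold pathConst; positivity
  obtain ⟨M, hM⟩ := exists_nat_ge (T / ε)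
  have hM' : T ≤ M * ε := (div_le_iff₀ hε0).1 hM
  -- The multiples of `ε` belong to every `Q P`, so that increments over distances at most `ε` give
  -- a bound uniform in `P`.
  let net : Finset ℝ := (Finset.range (M + 1)).image fun k : ℕ => (k : ℝ) * ε
  let Q : Finset ℝ → Finset ℝ := fun P => (P ∪ net).filter fun t => t ∈ Icc 0 T
  have hQ : ∀ P, ∀ t ∈ Q P, t ∈ Icc 0 T := fun P t ht => (Finset.mem_filter.1 ht).2
  have hnet : ∀ P, ∀ k : ℕ, k * ε ≤ T → k * ε ∈ Q P := fun P k hk => by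
    refine Finset.mem_filter.2 ⟨Finset.mem_union_right _ (Finset.mem_image.2 ⟨k, ?_, rfl⟩),
      by positivity, hk⟩
    rw [Finset.mem_range, Nat.lt_succ_iff]
    exact_mod_cast le_of_mul_le_mul_right (hk.trans hM') hε0
  have hQ0 : ∀ P, (0 : ℝ) ∈ Q P := fun P => by
    simpa using hnet P 0 (by simpa using hT.le)
  choose xs Ds hE using fun P =>
    exists_isEulerPath hζ hσ hR hκ hκ2 hB hε1 hL hε y (Q P) (hQ P) (hQ0 P)
  have hstep : ∀ P, ∀ s ∈ Q P, ∀ t ∈ Q P, s ≤ t → t - s ≤ ε →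
      ‖xs P t - xs P s‖ ≤ N * (t - s) ^ κ := fun P s hs t ht hst hle =>
    ((hE P).stepBound (hQ P) hσ hR hκ hκ2 hB hL0 hε1 hε hs ht hst hle).path
  set R := ‖y‖ + (M + 1) * N with hRdef
  have hbdd : ∀ P, ∀ t ∈ Q P, ‖xs P t‖ ≤ R := fun P t ht => by
    have := norm_le_of_net (x := xs P) hN0 (hQ P) hε0 hM' (hnet P)
      (fun s hs t ht hst hle => (hstep P s hs t ht hst hle).trans
        (mul_le_of_le_one_right hN0
          (Real.rpow_le_one (by linarith) (hle.trans hε1) (by linarith)))) ht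
    rwa [(hE P).initial] at this
  have hDbdd : ∀ P, ∀ t ∈ Q P, ‖Ds P t‖ ≤ B * T := fun P t ht => by
    have := (hE P).norm_drift_le (hQ P) hB (hQ0 P) ht (hQ P t ht).1
    rw [(hE P).drift_initial, sub_zero, sub_zero] at this
    exact this.trans (mul_le_mul_of_nonneg_left (hQ P t ht).2 hB0)
  -- In a proper space every bounded family converges along an ultrafilter, so pointwise limits
  -- exist at all times at once without extracting subsequences.
  let U : Ultrafilter (Finset ℝ) := Ultrafilter.of atTop
  have hU : (U : Filter (Finset ℝ)) ≤ atTop := Ultrafilter.of_le _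
  have hmem : ∀ t ∈ Icc 0 T, ∀ᶠ P in (U : Filter (Finset ℝ)), t ∈ Q P := fun t ht => by
    refine hU ((eventually_ge_atTop {t}).mono fun P hP => ?_)
    exact Finset.mem_filter.2 ⟨Finset.mem_union_left _ (hP (Finset.mem_singleton_self t)), ht⟩
  have hlim : ∀ (f : Finset ℝ → ℝ → E) (r : ℝ), (∀ P, ∀ t ∈ Q P, ‖f P t‖ ≤ r) →
      ∀ t ∈ Icc 0 T, ∃ a, ‖a‖ ≤ r ∧ Tendsto (fun P => f P t) (U : Filter (Finset ℝ)) (𝓝 a) := by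
    intro f r hf t ht
    obtain ⟨a, ha, hle⟩ := (isCompact_closedBall (0 : E) r).ultrafilter_le_nhds
      (U.map fun P => f P t) (by
        rw [le_principal_iff]
        exact (hmem t ht).mono fun P hP => by simpa using hf P t hP)
    exact ⟨a, by simpa using ha, hle⟩
  choose! x hxR hx using hlim xs R hbdd
  choose! D _ hD using hlim Ds (B * T) hDbdd
  refine ⟨x, D, R, ?_, hxR, ?_, ?_, ?_⟩
  · have h0 := hx 0 ⟨le_rfl, hT.le⟩
    exact tendsto_nhds_unique h0 (tendsto_const_nhds.congr fun P => (hE P).initial.symm)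
  · intro s t hs hst ht
    have sI : s ∈ Icc 0 T := ⟨hs, hst.trans ht⟩
    have tI : t ∈ Icc 0 T := ⟨hs.trans hst, ht⟩
    refine le_of_tendsto ((hD t tI).sub (hD s sI)).norm ?_
    filter_upwards [hmem s sI, hmem t tI] with P h1 h2
    exact (hE P).norm_drift_le (hQ P) hB h1 h2 hst
  · intro s t hs hst ht hle
    have sI : s ∈ Icc 0 T := ⟨hs, hst.trans ht⟩
    have tI : t ∈ Icc 0 T := ⟨hs.trans hst, ht⟩
    have c1 : Tendsto (fun P => σ s (xs P s) (incr ζ s t)) (U : Filter (Finset ℝ))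
        (𝓝 (σ s (x s) (incr ζ s t))) :=
      ((ContinuousLinearMap.apply ℝ E (incr ζ s t)).continuous.tendsto _).comp
        (((hσ.differentiable s sI).continuous.tendsto _).comp (hx s sI))
    have c2 : Tendsto (fun P => areaTerm (secondField σ s (xs P s)) (ζ2 s t))
        (U : Filter (Finset ℝ)) (𝓝 (areaTerm (secondField σ s (x s)) (ζ2 s t))) := by
      have hx' := tendsto_iff_norm_sub_tendsto_zero.1 (hx s sI)
      refine tendsto_iff_norm_sub_tendsto_zero.2 (squeeze_zero (fun _ => norm_nonneg _)
        (g := fun P => K ^ 2 * (2 * ‖xs P s - x s‖) * (Z * (t - s) ^ (2 * κ))) (fun P => ?_) ?_)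
      · rw [← areaTerm_sub_left]
        refine (hR.norm_areaTerm_le hs hst ht _).trans (mul_le_mul_of_nonneg_right ?_
          (mul_nonneg hZ (Real.rpow_nonneg (by linarith) _)))
        simpa using hσ.norm_secondField_sub_le sI sI (x s) (xs P s)
      · simpa using ((hx'.const_mul 2).const_mul (K ^ 2)).mul_const (Z * (t - s) ^ (2 * κ))
    refine le_of_tendsto ((((hx t tI).sub (hx s sI)).sub ((hD t tI).sub (hD s sI))).sub
      (c1.add c2)).norm ?_
    filter_upwards [hmem s sI, hmem t tI] with P h1 h2
    exact (hE P).expansion s h1 t h2 hst hle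
  -- Near `(s, x s)` the field `b` is within `η` of `b s (x s)`. The frozen-drift bound of the Euler
  -- paths then passes to the limit and gives the right derivative.
  · intro s hs
    have sI : s ∈ Icc 0 T := ⟨hs.1, hs.2.le⟩
    rw [hasDerivWithinAt_iff_isLittleO, Asymptotics.isLittleO_iff]
    intro η hη
    obtain ⟨δ, hδ0, hδ⟩ := Metric.continuousWithinAt_iff.1 (hb (s, x s) ⟨sI, mem_univ _⟩) η hη
    have hpow : Tendsto (fun t : ℝ => N * (t - s) ^ κ) (𝓝[>] s) (𝓝 0) := by
      have : ContinuousAt (fun t : ℝ => N * (t - s) ^ κ) s :=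
        continuousAt_const.mul (ContinuousAt.rpow_const (by fun_prop) (Or.inr (by linarith)))
      have h0 : (N * (s - s) ^ κ : ℝ) = 0 := by
        rw [sub_self, Real.zero_rpow (by linarith), mul_zero]
      rw [ContinuousAt, h0] at this
      exact this.mono_left nhdsWithin_le_nhds
    have hlt : ∀ r > 0, ∀ᶠ t in 𝓝[>] s, t < s + r := fun r hr =>
      nhdsWithin_le_nhds (eventually_lt_nhds (by linarith))
    filter_upwards [hpow.eventually_lt_const (half_pos hδ0), self_mem_nhdsWithin, hlt δ hδ0,
      hlt ε hε0, hlt (T - s) (by linarith [hs.2])] with t h1 h2 h3 h4 h5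
    have hst : s < t := h2
    have tI : t ∈ Icc 0 T := ⟨hs.1.trans hst.le, by linarith⟩
    rw [Real.norm_of_nonneg (by linarith)]
    refine le_of_tendsto (((hD t tI).sub (hD s sI)).sub_const _).norm ?_
    -- Convergence at the single time `s` suffices: the uniform Hölder bound `hstep` keeps `xs P u`
    -- close to `xs P s` for `u` between `s` and `t`.
    have hclose := (Metric.tendsto_nhds.1 (hx s sI)) (δ / 2) (half_pos hδ0)
    filter_upwards [hmem s sI, hmem t tI, hclose] with P hP1 hP2 hP3
    refine (hE P).drift s hP1 t hP2 hst.le _ η fun u hu hsu hut => ?_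
    have hxu : dist (xs P u) (x s) < δ := by
      refine (dist_triangle _ (xs P s) _).trans_lt ?_
      have h6 := hstep P s hP1 u hu hsu (by linarith)
      have h7 : N * (u - s) ^ κ ≤ N * (t - s) ^ κ := mul_le_mul_of_nonneg_left
        (Real.rpow_le_rpow (by linarith) (by linarith) (by linarith)) hN0
      rw [dist_eq_norm]
      linarith
    have := hδ (x := (u, xs P u)) ⟨hQ P u hu, mem_univ _⟩ (by
      rw [Prod.dist_eq]
      refine max_lt ?_ hxu
      rw [Real.dist_eq, abs_of_nonneg (by simpa using hsu)]
      simp only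
      linarith)
    rw [dist_eq_norm] at this
    exact this.le

end Existence

/-! ### The drift integral -/

open MeasureTheory

section Drift

variable {E : Type*} [NormedAddCommGroup E] {T B : ℝ} {b : ℝ → E → E} {x : ℝ → E}

lemma continuousOn_drift (hb : ContinuousOn (fun q : ℝ × E => b q.1 q.2) (Icc 0 T ×ˢ univ))
    (hx : ContinuousOn x (Icc 0 T)) : ContinuousOn (fun u => b u (x u)) (Icc 0 T) :=
  hb.comp (continuousOn_id.prodMk hx) fun _ hu => ⟨hu, mem_univ _⟩

lemma intervalIntegrable_drift
    (hb : ContinuousOn (fun q : ℝ × E => b q.1 q.2) (Icc 0 T ×ˢ univ))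
    (hx : ContinuousOn x (Icc 0 T)) {s t : ℝ} (hs : 0 ≤ s) (hst : s ≤ t) (ht : t ≤ T) :
    IntervalIntegrable (fun u => b u (x u)) volume s t :=
  ((continuousOn_drift hb hx).mono (Icc_subset_Icc hs ht)).intervalIntegrable_of_Icc hst

lemma norm_integral_drift_le [NormedSpace ℝ E] (hB : ∀ t ∈ Icc 0 T, ∀ x, ‖b t x‖ ≤ B) {s t : ℝ} (hs : 0 ≤ s)
    (hst : s ≤ t) (ht : t ≤ T) : ‖∫ u in s..t, b u (x u)‖ ≤ B * (t - s) := by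
  have := intervalIntegral.norm_integral_le_of_norm_le_const (f := fun u => b u (x u)) (C := B)
    (a := s) (b := t) fun u hu => by
      rw [uIoc_of_le hst] at hu
      exact hB u ⟨by linarith [hu.1], by linarith [hu.2]⟩ _
  rwa [abs_of_nonneg (by linarith)] at this

end Drift

/-! ### Paths with the local expansion are solutions -/

section Solution

variable {d m : ℕ} {T α κ K Z B L ε R : ℝ} {ζ : ℝ → Euc d}
  {ζ2 : ℝ → ℝ → Fin d → Fin d → ℝ} {b : ℝ → Euc m → Euc m}
  {σ : ℝ → Euc m → Euc d →L[ℝ] Euc m} {y : Euc m} {x : ℝ → Euc m}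

/-- A bounded path with the local expansion of the equation is a solution. -/
lemma isSolution_of_expansion (hT : 0 < T) (hζ : IsGeometricRoughPath T α ζ ζ2)
    (hσ : CoeffBound T K σ) (hκ : 1 / 3 < κ) (hκα : κ < α)
    (hκ2 : κ ≤ 1 / 2) (hR : RoughBound T κ Z ζ ζ2) (hB : ∀ t ∈ Icc 0 T, ∀ x, ‖b t x‖ ≤ B)
    (hb : ContinuousOn (fun q : ℝ × Euc m => b q.1 q.2) (Icc 0 T ×ˢ univ)) (hε0 : 0 < ε)
    (hε1 : ε ≤ 1) (hL0 : 0 ≤ L) (hε : L * ε ^ κ ≤ 1) (hx0 : x 0 = y)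
    (hxR : ∀ t ∈ Icc 0 T, ‖x t‖ ≤ R) (hxc : ContinuousOn x (Icc 0 T))
    (hexp : ∀ s t, 0 ≤ s → s ≤ t → t ≤ T → t - s ≤ ε →
      ‖x t - x s - (∫ u in s..t, b u (x u))
        - (σ s (x s) (incr ζ s t) + areaTerm (secondField σ s (x s)) (ζ2 s t))‖
        ≤ L * (t - s) ^ (3 * κ)) :
    IsSolution T κ ζ ζ2 b σ y x (fun s => σ s (x s)) ∧ Holder₁ T (min α 1) x := by
  have hK := hσ.nonneg
  have hZ := hR.nonneg
  have hB0 : 0 ≤ B := (norm_nonneg _).trans (hB 0 ⟨le_rfl, hT.le⟩ y)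
  set N := pathConst B K Z with hN
  have hstep : ∀ s t, 0 ≤ s → s ≤ t → t ≤ T → t - s ≤ ε →
      StepBound K κ N s t σ ζ (x s) (x t) := fun s t hs hst ht hle =>
    stepBound_of_isExpansion hσ hR hκ hκ2 hB0 hL0 hε1 hε hs hst ht hle
      (norm_integral_drift_le hB hs hst ht) (hexp s t hs hst ht hle)
  have hl : ∀ s t, 0 ≤ s → s ≤ t → t ≤ T → ∀ p : ℝ, 0 ≤ p → (t - s) ^ p ≤ T ^ p :=
    fun s t hs hst ht p hp => Real.rpow_le_rpow (by linarith) (by linarith) hp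
  have bx : ∀ s t, 0 ≤ s → s ≤ t → t ≤ T → ‖incr x s t‖ ≤ 2 * R := fun s t hs hst ht => by
    refine (norm_sub_le _ _).trans ?_
    linarith [hxR s ⟨hs, by linarith⟩, hxR t ⟨by linarith, ht⟩]
  have bσ : ∀ s t, 0 ≤ s → s ≤ t → t ≤ T → ‖σ t (x t) - σ s (x s)‖ ≤ 2 * K :=
    fun s t hs hst ht => by
      refine (norm_sub_le _ _).trans ?_
      linarith [hσ.norm_le s ⟨hs, by linarith⟩ (x s), hσ.norm_le t ⟨by linarith, ht⟩ (x t)]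
  have bF : ∀ s t, 0 ≤ s → s ≤ t → t ≤ T →
      ‖secondField σ t (x t) - secondField σ s (x s)‖ ≤ 2 * K ^ 2 := fun s t hs hst ht => by
    refine (norm_sub_le _ _).trans ?_
    linarith [hσ.norm_secondField_le (s := s) ⟨hs, by linarith⟩ (x s),
      hσ.norm_secondField_le (s := t) ⟨by linarith, ht⟩ (x t)]
  have bζ : ∀ s t, 0 ≤ s → s ≤ t → t ≤ T → ‖incr ζ s t‖ ≤ Z * T ^ κ := fun s t hs hst ht =>
    (hR.path s t hs hst ht).trans
      (mul_le_mul_of_nonneg_left (hl s t hs hst ht κ (by linarith)) hZ)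
  have bσζ : ∀ s t, 0 ≤ s → s ≤ t → t ≤ T → ‖σ s (x s) (incr ζ s t)‖ ≤ K * (Z * T ^ κ) :=
    fun s t hs hst ht => ContinuousLinearMap.le_of_opNorm_le_of_le _
      (hσ.norm_le s ⟨hs, by linarith⟩ _) (bζ s t hs hst ht)
  have bFζ : ∀ s t, 0 ≤ s → s ≤ t → t ≤ T →
      ‖secondField σ s (x s) (incr ζ s t)‖ ≤ K ^ 2 * (Z * T ^ κ) :=
    fun s t hs hst ht => ContinuousLinearMap.le_of_opNorm_le_of_le _
      (hσ.norm_secondField_le ⟨hs, by linarith⟩ _) (bζ s t hs hst ht)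
  have bA : ∀ s t, 0 ≤ s → s ≤ t → t ≤ T → ‖areaTerm (secondField σ s (x s)) (ζ2 s t)‖
      ≤ K ^ 2 * (Z * T ^ (2 * κ)) := fun s t hs hst ht =>
    (hR.norm_areaTerm_le hs hst ht _).trans (mul_le_mul
      (hσ.norm_secondField_le ⟨hs, by linarith⟩ _)
      (mul_le_mul_of_nonneg_left (hl s t hs hst ht _ (by linarith)) hZ)
      (mul_nonneg hZ (Real.rpow_nonneg (by linarith) _)) (by positivity))
  have bD : ∀ s t, 0 ≤ s → s ≤ t → t ≤ T → ‖∫ u in s..t, b u (x u)‖ ≤ B * T :=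
    fun s t hs hst ht => (norm_integral_drift_le hB hs hst ht).trans
      (mul_le_mul_of_nonneg_left (by linarith) hB0)
  have hx : Holder₁ T κ x := Holder₂.of_local hε0 (by linarith)
    (fun s t hs hst ht hle => (hstep s t hs hst ht hle).path) bx
  have hx' : Holder₁ T κ fun s => σ s (x s) := Holder₂.of_local hε0 (by linarith)
    (fun s t hs hst ht hle => (hstep s t hs hst ht hle).coeff) bσ
  have hxr : Holder₂ T (2 * κ) (remainder ζ x fun s => σ s (x s)) :=
    Holder₂.of_local hε0 (by linarith)
      (fun s t hs hst ht hle => (hstep s t hs hst ht hle).path_remainder)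
      fun s t hs hst ht => (norm_sub_le _ _).trans
        (add_le_add (bx s t hs hst ht) (bσζ s t hs hst ht))
  have hμ' : Holder₁ T κ fun s => secondField σ s (x s) := Holder₂.of_local hε0 (by linarith)
    (fun s t hs hst ht hle => (hstep s t hs hst ht hle).second) bF
  have hμr : Holder₂ T (2 * κ) (remainder ζ (fun s => σ s (x s))
      fun s => secondField σ s (x s)) :=
    Holder₂.of_local hε0 (by linarith)
      (fun s t hs hst ht hle => (hstep s t hs hst ht hle).coeff_remainder)
      fun s t hs hst ht => (norm_sub_le _ _).trans
        (add_le_add (bσ s t hs hst ht) (bFζ s t hs hst ht))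
  -- The sewing map is the expansion error itself. Over long times its Hölder bound is mere
  -- boundedness.
  let g : ℝ → ℝ → Euc m := fun s t => x t - x s - (∫ u in s..t, b u (x u))
        - (σ s (x s) (incr ζ s t) + areaTerm (secondField σ s (x s)) (ζ2 s t))
  have hg : Holder₂ T (3 * κ) g := Holder₂.of_local hε0 (by linarith) hexp
    fun s t hs hst ht => (norm_sub_le _ _).trans (add_le_add ((norm_sub_le _ _).trans
      (add_le_add (bx s t hs hst ht) (bD s t hs hst ht))) ((norm_add_le _ _).trans
      (add_le_add (bσζ s t hs hst ht) (bA s t hs hst ht))))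
  refine ⟨⟨hx0, ⟨hx, hx', hxr⟩, fun _ _ => rfl, ⟨hx', hμ', hμr⟩, g, ⟨hg, ?_⟩, ?_⟩, ?_⟩
  · intro s u t hs hsu hut ht
    have hint := intervalIntegral.integral_add_adjacent_intervals
      (intervalIntegrable_drift hb hxc hs hsu (by linarith))
      (intervalIntegrable_drift hb hxc (by linarith) hut ht)
    have hgd := germ_delta hζ hs hsu hut ht (σ s (x s)) (σ u (x u))
      (secondField σ s (x s)) (secondField σ u (x u))
    refine Eq.trans ?_ hgd
    simp only [delta, g, ← hint]
    abel
  · intro s t _ _ _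
    simp only [g, incr, secondField]
    abel
  -- In the expansion the drift has order `1`, the first-order term `α`, the area term `2α`, and the
  -- error `3κ > 1`; hence the exponent `min α 1`.
  · have hmin : 0 < min α 1 := lt_min (by linarith) one_pos
    have h1 : Holder₂ T (min α 1) fun s t => ∫ u in s..t, b u (x u) := by
      refine Holder₂.mono (p := 1) ⟨B, fun s t hs hst ht => ?_⟩ hmin (min_le_right _ _)
      rw [Real.rpow_one]
      exact norm_integral_drift_le hB hs hst ht
    have h2 : Holder₂ T (min α 1) fun s t => σ s (x s) (incr ζ s t) :=
      Holder₂.of_le K (Holder₂.mono hζ.holder_path hmin (min_le_left _ _))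
        fun s t hs hst ht => ContinuousLinearMap.le_of_opNorm_le _
          (hσ.norm_le s ⟨hs, by linarith⟩ _) _
    have h3 : Holder₂ T (min α 1) fun s t => areaTerm (secondField σ s (x s)) (ζ2 s t) :=
      Holder₂.of_le (K ^ 2 * (d : ℝ) ^ 2) (hζ.holder_area.mono hmin
        ((min_le_left _ _).trans (by linarith))) fun s t hs hst ht => by
          refine (RoughDE.norm_areaTerm_le _ _).trans ?_
          rw [mul_assoc]
          exact mul_le_mul_of_nonneg_right (hσ.norm_secondField_le ⟨hs, by linarith⟩ _)
            (by positivity)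
    have h4 : Holder₂ T (min α 1) g := hg.mono hmin ((min_le_right _ _).trans (by linarith))
    refine Holder₂.of_le 1 (((h1.add h2).add h3).add h4) fun s t _ _ _ => ?_
    rw [one_mul]
    refine le_of_eq (congrArg _ ?_)
    simp only [g, incr]
    abel

lemma exists_isSolution (hT : 0 < T) (hζ : IsGeometricRoughPath T α ζ ζ2)
    (hb : IsCb T 0 1 b) (hσ : IsCb T 1 2 σ) (hκ : 1 / 3 < κ) (hκα : κ < α) (hκ2 : κ ≤ 1 / 2)
    (y : Euc m) :
    ∃ x x', IsSolution T κ ζ ζ2 b σ y x x' ∧ Holder₁ T (min α 1) x := by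
  obtain ⟨K, hK⟩ := hσ.exists_coeffBound le_rfl
  obtain ⟨Z, hZ⟩ := hζ.exists_roughBound (by linarith) hκα.le
  obtain ⟨B, hB0, hB'⟩ := hb.exists_bound
  have hB : ∀ t ∈ Icc 0 T, ∀ x, ‖b t x‖ ≤ B := fun t ht x => by
    simpa using hB' 0 (by norm_num) t ht x
  set L := 2 * defectConst B K Z / (1 - 2 ^ (1 - 3 * κ)) with hL
  have hK0 := hK.nonneg
  have hZ0 := hZ.nonneg
  have hL0 : 0 ≤ L := by
    have hN0 : 0 ≤ pathConst B K Z := by unfold pathConst; positivity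
    have hA0 : 0 ≤ defectConst B K Z := by unfold defectConst; positivity
    exact div_nonneg (by linarith)
      (by linarith [two_rpow_one_sub_lt_one (θ := 3 * κ) (by linarith)])
  have hκ0 : 0 < κ := by linarith
  -- Chosen so that `ε ^ κ = 1 / (L + 1)`.
  set ε := (1 / (L + 1)) ^ (1 / κ) with hε
  have hε0 : 0 < ε := by positivity
  have hε1 : ε ≤ 1 := Real.rpow_le_one (by positivity)
    (by rw [div_le_one (by linarith)]; linarith) (by positivity)
  have hLε : L * ε ^ κ ≤ 1 := by
    rw [hε, ← Real.rpow_mul (by positivity), one_div_mul_cancel hκ0.ne', Real.rpow_one,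
      mul_one_div, div_le_one (by linarith)]
    linarith
  obtain ⟨x, D, R, hx0, hxR, hDB, hexp, hder⟩ := exists_limit_path hT hζ hK hZ hκ hκ2 hB
    hb.continuousOn hε0 hε1 hL0 hL hLε y
  have hxc : ContinuousOn x (Icc 0 T) := by
    have : Holder₁ T κ x := Holder₂.of_local (M := 2 * R) hε0 hκ0.le
      (fun s t hs hst ht hle => (stepBound_of_isExpansion hK hZ hκ hκ2 hB0 hL0 hε1 hLε hs hst ht
        hle (hDB s t hs hst ht) (hexp s t hs hst ht hle)).path) fun s t hs hst ht => by
          refine (norm_sub_le _ _).trans ?_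
          linarith [hxR s ⟨hs, by linarith⟩, hxR t ⟨by linarith, ht⟩]
    exact this.continuousOn hκ0
  have hDc : ContinuousOn D (Icc 0 T) := by
    have : Holder₁ T 1 D := ⟨B, fun s t hs hst ht => by
      rw [Real.rpow_one]; exact hDB s t hs hst ht⟩
    exact this.continuousOn one_pos
  have hDint : ∀ s t, 0 ≤ s → s ≤ t → t ≤ T → ∫ u in s..t, b u (x u) = D t - D s :=
    fun s t hs hst ht => intervalIntegral.integral_eq_sub_of_hasDeriv_right_of_le hst
      (hDc.mono (Icc_subset_Icc hs ht))
      (fun u hu => hder u ⟨by linarith [hu.1], by linarith [hu.2]⟩)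
      (intervalIntegrable_drift hb.continuousOn hxc hs hst ht)
  exact ⟨x, _, isSolution_of_expansion hT hζ hK hκ hκα hκ2 hZ hB hb.continuousOn hε0 hε1 hL0
    hLε hx0 hxR hxc fun s t hs hst ht hle => by
      rw [hDint s t hs hst ht]; exact hexp s t hs hst ht hle⟩

end Solution

/-! ### Stability of the expansion and uniqueness -/

section Uniqueness

section Difference

variable {E W : Type*} [NormedAddCommGroup E] [NormedSpace ℝ E]
  [NormedAddCommGroup W] [NormedSpace ℝ W] {T K C M κ : ℝ} {σ : ℝ → E → W →L[ℝ] E}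
  {s u : ℝ} {a₁ a₂ c₁ c₂ : E}

/-- The decomposition of `CoeffBound.norm_remainder_le` is differenced; each resulting term carries
a factor `M`. The exponent `2/3` is forced by the time increment of `σ`; the other terms have order
`2κ`. -/
lemma norm_remainder_sub_remainder_le (h : CoeffBound₃ T K σ) (hκ : 1 / 3 < κ)
    (hC : 0 ≤ C) (hs : s ∈ Icc 0 T) (hu : u ∈ Icc 0 T) (hsu : s ≤ u)
    (h1 : u - s ≤ 1) {w : W} (ha : ‖a₁ - a₂‖ ≤ M) (hc : ‖c₁ - c₂‖ ≤ M)
    (hp₁ : ‖c₁ - a₁‖ ≤ C * (u - s) ^ κ) (hp₂ : ‖c₂ - a₂‖ ≤ C * (u - s) ^ κ)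
    (hr₁ : ‖c₁ - a₁ - σ s a₁ w‖ ≤ C * (u - s) ^ (2 * κ))
    (hd : ‖(c₁ - a₁) - (c₂ - a₂)‖ ≤ M * (u - s) ^ κ)
    (hr : ‖(c₁ - a₁ - σ s a₁ w) - (c₂ - a₂ - σ s a₂ w)‖ ≤ M * (u - s) ^ (2 * κ)) :
    ‖(σ u c₁ - σ s a₁ - secondField σ s a₁ w) - (σ u c₂ - σ s a₂ - secondField σ s a₂ w)‖
      ≤ K * (2 + 3 * C + C ^ 2) * M * (u - s) ^ (2 / 3 : ℝ) := by
  have hK := h.nonneg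
  have hM : 0 ≤ M := (norm_nonneg _).trans ha
  have w0 : 0 ≤ u - s := sub_nonneg.2 hsu
  have habs : |u - s| = u - s := abs_of_nonneg w0
  set q := (u - s) ^ κ with hq
  have q0 : 0 ≤ q := Real.rpow_nonneg w0 _
  have q2 : (u - s) ^ (2 * κ) = q ^ 2 := by
    rw [hq, ← Real.rpow_mul_natCast w0, mul_comm]; norm_num
  have p1 : q ^ 2 ≤ (u - s) ^ (2 / 3 : ℝ) := by
    rw [← q2]; exact rpow_le_rpow_of_le_one w0 h1 (by norm_num) (by linarith)
  rw [q2] at hr₁ hr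
  have t1 : ‖(σ u c₁ - σ s c₁) - (σ u c₂ - σ s c₂)‖ ≤ K * (u - s) ^ (2 / 3 : ℝ) * M := by
    have hsub : ∀ x, fderiv ℝ (fun x => σ u x - σ s x) x = fderiv ℝ (σ u) x - fderiv ℝ (σ s) x :=
      fun x => fderiv_fun_sub (h.differentiable u hu x) (h.differentiable s hs x)
    refine (norm_sub_le_of_norm_fderiv_le (f := fun x => σ u x - σ s x)
      ((h.differentiable u hu).sub (h.differentiable s hs)) (C := K * (u - s) ^ (2 / 3 : ℝ))
      (fun x => ?_) c₂ c₁).trans (mul_le_mul_of_nonneg_left hc (by positivity))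
    rw [hsub]
    simpa only [habs] using h.fderiv_time₃ s hs u hu x
  have t2 := norm_taylor_sub_taylor_le (M := M) (h.differentiable s hs) (h.differentiable₂ s hs)
    (h.fderiv₂_le s hs) (h.fderiv₂_lip s hs) (x₁ := a₁) (x₂ := a₂) (h₁ := c₁ - a₁)
    (h₂ := c₂ - a₂) ha (by simpa using hc)
  simp only [add_sub_cancel] at t2
  have t2' := t2.trans (show _ ≤ K * (M * q + M * (C * q)) * (C * q) + K * (C * q) * (M * q) by
    gcongr)
  have t3 : ‖(fderiv ℝ (σ s) a₁ - fderiv ℝ (σ s) a₂) (c₁ - a₁ - σ s a₁ w)‖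
      ≤ K * M * (C * q ^ 2) :=
    ContinuousLinearMap.le_of_opNorm_le_of_le _
      ((h.fderiv_lip s hs a₂ a₁).trans (mul_le_mul_of_nonneg_left ha hK)) hr₁
  have t4 : ‖fderiv ℝ (σ s) a₂ ((c₁ - a₁ - σ s a₁ w) - (c₂ - a₂ - σ s a₂ w))‖
      ≤ K * (M * q ^ 2) :=
    ContinuousLinearMap.le_of_opNorm_le_of_le _ (h.fderiv_le s hs a₂) hr
  have e : (σ u c₁ - σ s a₁ - secondField σ s a₁ w) - (σ u c₂ - σ s a₂ - secondField σ s a₂ w)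
      = ((σ u c₁ - σ s c₁) - (σ u c₂ - σ s c₂))
        + ((σ s c₁ - σ s a₁ - fderiv ℝ (σ s) a₁ (c₁ - a₁))
          - (σ s c₂ - σ s a₂ - fderiv ℝ (σ s) a₂ (c₂ - a₂)))
        + (fderiv ℝ (σ s) a₁ - fderiv ℝ (σ s) a₂) (c₁ - a₁ - σ s a₁ w)
        + fderiv ℝ (σ s) a₂ ((c₁ - a₁ - σ s a₁ w) - (c₂ - a₂ - σ s a₂ w)) := by
    simp only [secondField, ContinuousLinearMap.comp_apply, map_sub, sub_apply]
    abel
  rw [e]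
  refine norm_add₄_le.trans ((add_le_add (add_le_add (add_le_add t1 t2') t3) t4).trans ?_)
  have : K * (1 + 3 * C + C ^ 2) * M * q ^ 2 ≤ K * (1 + 3 * C + C ^ 2) * M
      * (u - s) ^ (2 / 3 : ℝ) := mul_le_mul_of_nonneg_left p1 (by positivity)
  calc _ = K * M * (u - s) ^ (2 / 3 : ℝ) + K * (1 + 3 * C + C ^ 2) * M * q ^ 2 := by ring
    _ ≤ K * M * (u - s) ^ (2 / 3 : ℝ)
        + K * (1 + 3 * C + C ^ 2) * M * (u - s) ^ (2 / 3 : ℝ) := by linarith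
    _ = _ := by ring

/-- The four-point estimate for a time-dependent function. -/
lemma norm_time_four_point_le {G : Type*} [NormedAddCommGroup G] [NormedSpace ℝ G]
    {f g : E → G} {K C M q r : ℝ} (hM : 0 ≤ M) (hK0 : 0 ≤ K) (hf : Differentiable ℝ f)
    (hg : Differentiable ℝ g)
    (hK : ∀ x, ‖fderiv ℝ f x‖ ≤ K) (hK' : ∀ x y, ‖fderiv ℝ f y - fderiv ℝ f x‖ ≤ K * ‖y - x‖)
    (hfg : ∀ x, ‖fderiv ℝ g x - fderiv ℝ f x‖ ≤ K * r) (hr : 0 ≤ r) (hqr : q ≤ r)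
    (hC : 0 ≤ C) (hc : ‖c₁ - c₂‖ ≤ M) (hp : ‖c₂ - a₂‖ ≤ C * q)
    (hd : ‖(c₁ - a₁) - (c₂ - a₂)‖ ≤ M * q) :
    ‖(g c₁ - f a₁) - (g c₂ - f a₂)‖ ≤ K * (2 + C) * M * r := by
  have t1 : ‖(g c₁ - f c₁) - (g c₂ - f c₂)‖ ≤ K * r * M := by
    refine (norm_sub_le_of_norm_fderiv_le (f := fun x => g x - f x) (hg.sub hf) (C := K * r)
      (fun x => ?_) c₂ c₁).trans (mul_le_mul_of_nonneg_left hc (by positivity))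
    rw [fderiv_fun_sub (hg x) (hf x)]
    exact hfg x
  have t2 := norm_four_point_le hf hK hK' c₁ c₂ a₁ a₂
  have e1 : c₁ - c₂ - (a₁ - a₂) = (c₁ - a₁) - (c₂ - a₂) := by abel
  rw [e1] at t2
  have t2' := t2.trans (show _ ≤ K * (M * q) + K * M * (C * q) by gcongr)
  have e : (g c₁ - f a₁) - (g c₂ - f a₂)
      = ((g c₁ - f c₁) - (g c₂ - f c₂)) + (f c₁ - f c₂ - (f a₁ - f a₂)) := by abel
  rw [e]
  refine (norm_add_le _ _).trans ((add_le_add t1 t2').trans ?_)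
  have : K * (1 + C) * M * q ≤ K * (1 + C) * M * r := mul_le_mul_of_nonneg_left hqr (by positivity)
  linarith

/-- Product rule for the difference of `∇σ σ`, with the four-point estimate applied to `σ` and to
`∇σ`. The exponent `1/3` is the time regularity of `∇²σ`. -/
lemma norm_secondField_four_point_le (h : CoeffBound₃ T K σ) (hκ : 1 / 3 < κ)
    (hC : 0 ≤ C) (hs : s ∈ Icc 0 T) (hu : u ∈ Icc 0 T) (hsu : s ≤ u)
    (h1 : u - s ≤ 1) (ha : ‖a₁ - a₂‖ ≤ M) (hc : ‖c₁ - c₂‖ ≤ M)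
    (hp₁ : ‖c₁ - a₁‖ ≤ C * (u - s) ^ κ) (hp₂ : ‖c₂ - a₂‖ ≤ C * (u - s) ^ κ)
    (hd : ‖(c₁ - a₁) - (c₂ - a₂)‖ ≤ M * (u - s) ^ κ) :
    ‖(secondField σ u c₁ - secondField σ s a₁) - (secondField σ u c₂ - secondField σ s a₂)‖
      ≤ K ^ 2 * (6 + 4 * C) * M * (u - s) ^ (1 / 3 : ℝ) := by
  have hK := h.nonneg
  have hM : 0 ≤ M := (norm_nonneg _).trans ha
  have w0 : 0 ≤ u - s := sub_nonneg.2 hsu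
  have habs : |u - s| = u - s := abs_of_nonneg w0
  set r := (u - s) ^ (1 / 3 : ℝ) with hr
  have r0 : 0 ≤ r := Real.rpow_nonneg w0 _
  have q0 : 0 ≤ (u - s) ^ κ := Real.rpow_nonneg w0 _
  have p1 : (u - s) ^ κ ≤ r := rpow_le_rpow_of_le_one w0 h1 (by norm_num) hκ.le
  have p2 : (u - s) ^ (2 / 3 : ℝ) ≤ r :=
    rpow_le_rpow_of_le_one w0 h1 (by norm_num) (by norm_num)
  have p3 : (u - s) ≤ r := by
    have := rpow_le_rpow_of_le_one w0 h1 (by norm_num) (by norm_num : (1 / 3 : ℝ) ≤ 1)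
    rwa [Real.rpow_one] at this
  have hcr : ∀ v : E, ‖v‖ ≤ C * (u - s) ^ κ → ‖v‖ ≤ C * r := fun v hv =>
    hv.trans (mul_le_mul_of_nonneg_left p1 hC)
  have f1 : ‖(σ u c₁ - σ s a₁) - (σ u c₂ - σ s a₂)‖ ≤ K * (2 + C) * M * r :=
    norm_time_four_point_le hM hK (h.differentiable s hs) (h.differentiable u hu)
      (h.fderiv_le s hs) (h.fderiv_lip s hs)
      (fun x => (h.fderiv_time₃ s hs u hu x).trans
        (by rw [habs]; exact mul_le_mul_of_nonneg_left p2 hK)) r0 p1 hC hc hp₂ hd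
  have f2 : ‖(fderiv ℝ (σ u) c₁ - fderiv ℝ (σ s) a₁) - (fderiv ℝ (σ u) c₂ - fderiv ℝ (σ s) a₂)‖
      ≤ K * (2 + C) * M * r :=
    norm_time_four_point_le hM hK (h.differentiable₂ s hs) (h.differentiable₂ u hu)
      (h.fderiv₂_le s hs) (h.fderiv₂_lip s hs)
      (fun x => (h.fderiv₂_time s hs u hu x).trans (by rw [habs])) r0 p1 hC hc hp₂ hd
  have g1 : ‖fderiv ℝ (σ s) a₁ - fderiv ℝ (σ s) a₂‖ ≤ K * M :=
    (h.fderiv_lip s hs a₂ a₁).trans (mul_le_mul_of_nonneg_left ha hK)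
  have g2 : ‖σ u c₁ - σ u c₂‖ ≤ K * M :=
    (norm_sub_le_of_norm_fderiv_le (h.differentiable u hu) (h.fderiv_le u hu) c₂ c₁).trans
      (mul_le_mul_of_nonneg_left hc hK)
  have g3 : ‖σ u c₁ - σ s a₁‖ ≤ K * (1 + C) * r := by
    refine (h.norm_sub_le hs hu a₁ c₁).trans ?_
    rw [habs]
    have := mul_le_mul_of_nonneg_left p3 hK
    have := mul_le_mul_of_nonneg_left (hcr _ hp₁) hK
    linarith
  have g4 : ‖fderiv ℝ (σ u) c₂ - fderiv ℝ (σ s) a₂‖ ≤ K * (1 + C) * r := by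
    have e : fderiv ℝ (σ u) c₂ - fderiv ℝ (σ s) a₂ = (fderiv ℝ (σ u) c₂ - fderiv ℝ (σ s) c₂)
      + (fderiv ℝ (σ s) c₂ - fderiv ℝ (σ s) a₂) := by abel
    rw [e]
    refine (norm_add_le _ _).trans ((add_le_add (h.fderiv_time₃ s hs u hu c₂)
      (h.fderiv_lip s hs a₂ c₂)).trans ?_)
    rw [habs]
    have := mul_le_mul_of_nonneg_left p2 hK
    have := mul_le_mul_of_nonneg_left (hcr _ hp₂) hK
    linarith
  have e : (secondField σ u c₁ - secondField σ s a₁) - (secondField σ u c₂ - secondField σ s a₂)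
      = ((fderiv ℝ (σ u) c₁ - fderiv ℝ (σ s) a₁)
          - (fderiv ℝ (σ u) c₂ - fderiv ℝ (σ s) a₂)).comp (σ u c₁)
        + (fderiv ℝ (σ s) a₁ - fderiv ℝ (σ s) a₂).comp (σ u c₁ - σ s a₁)
        + (fderiv ℝ (σ u) c₂ - fderiv ℝ (σ s) a₂).comp (σ u c₁ - σ u c₂)
        + (fderiv ℝ (σ s) a₂).comp ((σ u c₁ - σ s a₁) - (σ u c₂ - σ s a₂)) := by
    simp only [secondField, ContinuousLinearMap.sub_comp, ContinuousLinearMap.comp_sub]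
    abel
  have comp_le : ∀ {A : E →L[ℝ] W →L[ℝ] E} {S : W →L[ℝ] E} {α β : ℝ}, ‖A‖ ≤ α → ‖S‖ ≤ β →
      ‖A.comp S‖ ≤ α * β := fun hA hS => (ContinuousLinearMap.opNorm_comp_le _ _).trans
    (mul_le_mul hA hS (norm_nonneg _) ((norm_nonneg _).trans hA))
  rw [e]
  refine norm_add₄_le.trans ((add_le_add (add_le_add (add_le_add
    (comp_le f2 (h.norm_le u hu c₁)) (comp_le g1 g3)) (comp_le g4 g2))
    (comp_le (h.fderiv_le s hs a₂) f1)).trans (le_of_eq ?_))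
  ring

end Difference

variable {d : ℕ} {E : Type*} [NormedAddCommGroup E] [NormedSpace ℝ E] {T κ K Z B C : ℝ}
  {σ : ℝ → E → Euc d →L[ℝ] E} {ζ : ℝ → Euc d} {ζ2 : ℝ → ℝ → Fin d → Fin d → ℝ}
  {x₁ x₂ : ℝ → E} {V R : ℝ → ℝ → E}

/-- A difference `x₁ - x₂` with drift `V` and remainder `R` in its local expansion. -/
structure IsDifference (T κ B C : ℝ) (σ : ℝ → E → Euc d →L[ℝ] E) (ζ : ℝ → Euc d)
    (ζ2 : ℝ → ℝ → Fin d → Fin d → ℝ) (x₁ x₂ : ℝ → E) (V R : ℝ → ℝ → E) : Prop where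
  nonneg : 0 ≤ C
  path₁ : ∀ s t, 0 ≤ s → s ≤ t → t ≤ T → ‖x₁ t - x₁ s‖ ≤ C * (t - s) ^ κ
  path₂ : ∀ s t, 0 ≤ s → s ≤ t → t ≤ T → ‖x₂ t - x₂ s‖ ≤ C * (t - s) ^ κ
  remainder₁ : ∀ s t, 0 ≤ s → s ≤ t → t ≤ T →
    ‖x₁ t - x₁ s - σ s (x₁ s) (incr ζ s t)‖ ≤ C * (t - s) ^ (2 * κ)
  drift : ∀ s t M, 0 ≤ s → s ≤ t → t ≤ T → (∀ u, s ≤ u → u ≤ t → ‖x₁ u - x₂ u‖ ≤ M) →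
    ‖V s t‖ ≤ B * M * (t - s)
  order : ∀ s t, 0 ≤ s → s ≤ t → t ≤ T → ‖R s t‖ ≤ C * (t - s) ^ (3 * κ)
  expansion : ∀ s t, 0 ≤ s → s ≤ t → t ≤ T → (x₁ t - x₁ s) - (x₂ t - x₂ s)
    = V s t + (σ s (x₁ s) - σ s (x₂ s)) (incr ζ s t)
      + areaTerm (secondField σ s (x₁ s) - secondField σ s (x₂ s)) (ζ2 s t) + R s t
  defect : ∀ s u t, 0 ≤ s → s ≤ u → u ≤ t → t ≤ T → delta R s u t
    = ((σ u (x₁ u) - σ s (x₁ s) - secondField σ s (x₁ s) (incr ζ s u))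
        - (σ u (x₂ u) - σ s (x₂ s) - secondField σ s (x₂ s) (incr ζ s u))) (incr ζ u t)
      + areaTerm ((secondField σ u (x₁ u) - secondField σ s (x₁ s))
        - (secondField σ u (x₂ u) - secondField σ s (x₂ s))) (ζ2 u t)

/-- Hölder constant for the difference of two solutions. -/
noncomputable def diffConst (B K Z : ℝ) : ℝ := B + K * Z + 2 * K ^ 2 * Z + 1

/-- Constant for the defect of additivity of the difference of two solutions. -/
noncomputable def diffDefectConst (B K Z C : ℝ) : ℝ :=
  diffConst B K Z * Z * (K * (2 + 3 * C + C ^ 2) + K ^ 2 * (6 + 4 * C))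

/-- Every term of the expansion is linear in `M`. The bound on `R` is an assumption, because it is
improved together with `M` in the iteration of `IsDifference.eq_of_eq`. -/
lemma IsDifference.norm_incr_le (h : IsDifference T κ B C σ ζ ζ2 x₁ x₂ V R)
    (hσ : CoeffBound T K σ) (hR : RoughBound T κ Z ζ ζ2) (hκ : 1 / 3 < κ) (hκ2 : κ ≤ 1 / 2)
    (hB : 0 ≤ B) {s t M : ℝ} (hs : 0 ≤ s) (hst : s ≤ t) (ht : t ≤ T) (h1 : t - s ≤ 1)
    (hM : ∀ u, s ≤ u → u ≤ t → ‖x₁ u - x₂ u‖ ≤ M) (hRM : ‖R s t‖ ≤ M * (t - s) ^ (2 * κ)) :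
    ‖(x₁ t - x₁ s) - (x₂ t - x₂ s)‖ ≤ diffConst B K Z * M * (t - s) ^ κ ∧
    ‖(x₁ t - x₁ s - σ s (x₁ s) (incr ζ s t)) - (x₂ t - x₂ s - σ s (x₂ s) (incr ζ s t))‖
      ≤ diffConst B K Z * M * (t - s) ^ (2 * κ) := by
  have hK := hσ.nonneg
  have hZ := hR.nonneg
  have sI : s ∈ Icc 0 T := ⟨hs, hst.trans ht⟩
  have hMs := hM s le_rfl hst
  have hM0 : 0 ≤ M := (norm_nonneg _).trans hMs
  have w0 : 0 ≤ t - s := sub_nonneg.2 hst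
  have p1 : t - s ≤ (t - s) ^ (2 * κ) := by
    simpa using rpow_le_rpow_of_le_one (p := 1) w0 h1 (by linarith) (by linarith : 2 * κ ≤ 1)
  have p2 : (t - s) ^ (2 * κ) ≤ (t - s) ^ κ :=
    rpow_le_rpow_of_le_one w0 h1 (by linarith) (by linarith)
  have q1 : 0 ≤ (t - s) ^ (2 * κ) := Real.rpow_nonneg w0 _
  have b1 : ‖V s t‖ ≤ B * M * (t - s) ^ (2 * κ) :=
    (h.drift s t M hs hst ht hM).trans (mul_le_mul_of_nonneg_left p1 (by positivity))
  have b2 : ‖(σ s (x₁ s) - σ s (x₂ s)) (incr ζ s t)‖ ≤ K * M * (Z * (t - s) ^ κ) :=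
    ContinuousLinearMap.le_of_opNorm_le_of_le _
      ((norm_sub_le_of_norm_fderiv_le (hσ.differentiable s sI) (hσ.fderiv_le s sI) _ _).trans
        (mul_le_mul_of_nonneg_left hMs hK)) (hR.path s t hs hst ht)
  have b3 : ‖areaTerm (secondField σ s (x₁ s) - secondField σ s (x₂ s)) (ζ2 s t)‖
      ≤ K ^ 2 * (2 * M) * (Z * (t - s) ^ (2 * κ)) := by
    refine (hR.norm_areaTerm_le hs hst ht _).trans
      (mul_le_mul_of_nonneg_right ?_ (by positivity))
    have := hσ.norm_secondField_sub_le sI sI (x₂ s) (x₁ s)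
    rw [sub_self, abs_zero, Real.zero_rpow (by norm_num), zero_add, zero_add] at this
    exact this.trans (by gcongr)
  have key : ‖V s t + areaTerm (secondField σ s (x₁ s) - secondField σ s (x₂ s)) (ζ2 s t) + R s t‖
      ≤ (B + 2 * K ^ 2 * Z + 1) * M * (t - s) ^ (2 * κ) := by
    refine norm_add₃_le.trans ((add_le_add (add_le_add b1 b3) hRM).trans (le_of_eq ?_))
    ring
  have hexp := h.expansion s t hs hst ht
  constructor
  · have e : (x₁ t - x₁ s) - (x₂ t - x₂ s)
        = (V s t + areaTerm (secondField σ s (x₁ s) - secondField σ s (x₂ s)) (ζ2 s t) + R s t)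
          + (σ s (x₁ s) - σ s (x₂ s)) (incr ζ s t) := by rw [hexp]; abel
    rw [e]
    refine (norm_add_le _ _).trans ((add_le_add key b2).trans ?_)
    have : (B + 2 * K ^ 2 * Z + 1) * M * (t - s) ^ (2 * κ)
        ≤ (B + 2 * K ^ 2 * Z + 1) * M * (t - s) ^ κ :=
      mul_le_mul_of_nonneg_left p2 (by positivity)
    unfold diffConst
    linarith
  · have e : (x₁ t - x₁ s - σ s (x₁ s) (incr ζ s t)) - (x₂ t - x₂ s - σ s (x₂ s) (incr ζ s t))
        = V s t + areaTerm (secondField σ s (x₁ s) - secondField σ s (x₂ s)) (ζ2 s t)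
          + R s t := by
      have e' : (x₁ t - x₁ s - σ s (x₁ s) (incr ζ s t)) - (x₂ t - x₂ s - σ s (x₂ s) (incr ζ s t))
        = ((x₁ t - x₁ s) - (x₂ t - x₂ s)) - (σ s (x₁ s) - σ s (x₂ s)) (incr ζ s t) := by
        rw [sub_apply]; abel
      rw [e', hexp]; abel
    rw [e]
    refine key.trans ?_
    have : 0 ≤ K * Z * M * (t - s) ^ (2 * κ) := by positivity
    unfold diffConst
    linarith

lemma IsDifference.norm_delta_le (h : IsDifference T κ B C σ ζ ζ2 x₁ x₂ V R)
    (hσ : CoeffBound₃ T K σ) (hR : RoughBound T κ Z ζ ζ2) (hκ : 1 / 3 < κ) (hκ2 : κ ≤ 1 / 2)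
    (hB : 0 ≤ B) {s u t M : ℝ} (hs : 0 ≤ s) (hsu : s ≤ u) (hut : u ≤ t) (ht : t ≤ T)
    (h1 : t - s ≤ 1) (hM : ∀ v, s ≤ v → v ≤ u → ‖x₁ v - x₂ v‖ ≤ M)
    (hRM : ‖R s u‖ ≤ M * (u - s) ^ (2 * κ)) :
    ‖delta R s u t‖ ≤ diffDefectConst B K Z C * M * (t - s) ^ (2 / 3 + κ) := by
  have hK := hσ.nonneg
  have hZ := hR.nonneg
  have hC := h.nonneg
  have sI : s ∈ Icc 0 T := ⟨hs, by linarith⟩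
  have uI : u ∈ Icc 0 T := ⟨by linarith, by linarith⟩
  have hM0 : 0 ≤ M := (norm_nonneg _).trans (hM s le_rfl hsu)
  obtain ⟨i1, i2⟩ := h.norm_incr_le hσ.toCoeffBound hR hκ hκ2 hB hs hsu uI.2 (by linarith) hM hRM
  set N := diffConst B K Z with hN
  have hN1 : 1 ≤ N := by
    rw [hN]; unfold diffConst
    have : 0 ≤ B + K * Z + 2 * K ^ 2 * Z := by positivity
    linarith
  -- Since `N ≥ 1`, the single constant `N * M` bounds the differences of the values and of their
  -- increments alike.
  have hMN : M ≤ N * M := le_mul_of_one_le_left hM0 hN1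
  have ha := (hM s le_rfl hsu).trans hMN
  have hc := (hM u hsu le_rfl).trans hMN
  have d1 := norm_remainder_sub_remainder_le hσ hκ hC sI uI hsu (by linarith) ha hc
    (h.path₁ s u hs hsu uI.2) (h.path₂ s u hs hsu uI.2) (h.remainder₁ s u hs hsu uI.2) i1 i2
  have d2 := norm_secondField_four_point_le hσ hκ hC sI uI hsu (by linarith) ha hc
    (h.path₁ s u hs hsu uI.2) (h.path₂ s u hs hsu uI.2) i1
  have hl : 0 ≤ t - s := by linarith
  have m1 : ∀ p : ℝ, 0 ≤ p → (u - s) ^ p ≤ (t - s) ^ p := fun p hp =>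
    Real.rpow_le_rpow (by linarith) (by linarith) hp
  have m2 : ∀ p : ℝ, 0 ≤ p → (t - u) ^ p ≤ (t - s) ^ p := fun p hp =>
    Real.rpow_le_rpow (by linarith) (by linarith) hp
  have r0 : ∀ p : ℝ, 0 ≤ (t - s) ^ p := fun p => Real.rpow_nonneg hl p
  have e1 : (t - s) ^ (2 / 3 : ℝ) * (t - s) ^ κ = (t - s) ^ (2 / 3 + κ) :=
    (Real.rpow_add_of_nonneg hl (by norm_num) (by linarith)).symm
  -- Here `1/3 + 2κ ≥ 2/3 + κ` because `κ ≥ 1/3`.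
  have e2 : (t - s) ^ (1 / 3 : ℝ) * (t - s) ^ (2 * κ) ≤ (t - s) ^ (2 / 3 + κ) := by
    rw [← Real.rpow_add_of_nonneg hl (by norm_num) (by linarith)]
    exact rpow_le_rpow_of_le_one hl h1 (by linarith) (by linarith)
  rw [h.defect s u t hs hsu hut ht]
  have j1 := ContinuousLinearMap.le_of_opNorm_le_of_le _
    (d1.trans (mul_le_mul_of_nonneg_left (m1 (2 / 3) (by norm_num)) (by positivity)))
    ((hR.path u t uI.1 hut ht).trans (mul_le_mul_of_nonneg_left (m2 κ (by linarith)) hZ))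
  have j2 := (hR.norm_areaTerm_le uI.1 hut ht _).trans (mul_le_mul
    (d2.trans (mul_le_mul_of_nonneg_left (m1 (1 / 3) (by norm_num)) (by positivity)))
    (mul_le_mul_of_nonneg_left (m2 (2 * κ) (by linarith)) hZ)
    (mul_nonneg hZ (Real.rpow_nonneg (by linarith) _))
    (mul_nonneg (by positivity) (r0 _)))
  refine (norm_add_le _ _).trans ((add_le_add j1 j2).trans ?_)
  have e3 : K ^ 2 * (6 + 4 * C) * (N * M) * Z * ((t - s) ^ (1 / 3 : ℝ) * (t - s) ^ (2 * κ))
      ≤ K ^ 2 * (6 + 4 * C) * (N * M) * Z * (t - s) ^ (2 / 3 + κ) :=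
    mul_le_mul_of_nonneg_left e2 (by positivity)
  calc _ = K * (2 + 3 * C + C ^ 2) * (N * M) * Z * ((t - s) ^ (2 / 3 : ℝ) * (t - s) ^ κ)
        + K ^ 2 * (6 + 4 * C) * (N * M) * Z * ((t - s) ^ (1 / 3 : ℝ) * (t - s) ^ (2 * κ)) := by
        ring
    _ ≤ K * (2 + 3 * C + C ^ 2) * (N * M) * Z * (t - s) ^ (2 / 3 + κ)
        + K ^ 2 * (6 + 4 * C) * (N * M) * Z * (t - s) ^ (2 / 3 + κ) := by
        rw [e1]; linarith
    _ = _ := by unfold diffDefectConst; rw [← hN]; ring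

/-- A contraction: `‖x₁ - x₂‖` and the constant of `R` in order `2κ` are bounded by the same `M`,
and on short intervals both are halved. The length `η` is independent of `a`, which makes chaining
possible. -/
lemma IsDifference.eq_of_eq (h : IsDifference T κ B C σ ζ ζ2 x₁ x₂ V R)
    (hσ : CoeffBound₃ T K σ) (hR : RoughBound T κ Z ζ ζ2) (hκ : 1 / 3 < κ) (hκ2 : κ ≤ 1 / 2)
    (hB : 0 ≤ B) :
    ∃ η : ℝ, 0 < η ∧ ∀ a e, 0 ≤ a → a ≤ e → e ≤ T → e - a ≤ η → x₁ a = x₂ a → x₁ e = x₂ e := by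
  have hK := hσ.nonneg
  have hZ := hR.nonneg
  have hC := h.nonneg
  set N := diffConst B K Z with hN
  have hN0 : 0 ≤ N := by rw [hN]; unfold diffConst; positivity
  set A := diffDefectConst B K Z C / (1 - 2 ^ (1 - (2 / 3 + κ))) with hA
  have hA0 : 0 ≤ A := by
    refine div_nonneg ?_ (by linarith [two_rpow_one_sub_lt_one (θ := 2 / 3 + κ) (by linarith)])
    unfold diffDefectConst
    rw [← hN]
    positivity
  set c := 1 / (2 * (N + A + 1)) with hc
  have hc0 : 0 < c := by positivity
  have hc1 : c ≤ 1 := by rw [hc, div_le_one (by positivity)]; linarith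
  have hcNA : (N + A) * c ≤ 1 / 2 := by
    rw [hc, mul_one_div, div_le_iff₀ (by positivity)]; linarith
  -- The gained powers have exponents `κ` and `2/3 - κ`, both at least `1/6` as `1/3 < κ ≤ 1/2`; on
  -- lengths at most `c ^ 6` such powers are at most `c`.
  refine ⟨c ^ 6, by positivity, fun a e ha hae he hle hxa => ?_⟩
  have hη1 : c ^ 6 ≤ 1 := pow_le_one₀ hc0.le hc1
  have hsmall : ∀ l : ℝ, 0 ≤ l → l ≤ c ^ 6 → ∀ p : ℝ, 1 / 6 ≤ p → l ^ p ≤ c := by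
    intro l hl hlc p hp
    refine (rpow_le_rpow_of_le_one hl (hlc.trans hη1) (by norm_num) hp).trans ?_
    refine (Real.rpow_le_rpow hl hlc (by norm_num)).trans (le_of_eq ?_)
    rw [← Real.rpow_natCast, ← Real.rpow_mul hc0.le]
    norm_num
  have key : ∀ n : ℕ, (∀ s, a ≤ s → s ≤ e → ‖x₁ s - x₂ s‖ ≤ 2 * C * (1 / 2) ^ n) ∧
      ∀ s t, a ≤ s → s ≤ t → t ≤ e → ‖R s t‖ ≤ 2 * C * (1 / 2) ^ n * (t - s) ^ (2 * κ) := by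
    intro n
    induction n with
    | zero =>
      simp only [pow_zero, mul_one]
      refine ⟨fun s has hse => ?_, fun s t has hst hte => ?_⟩
      · have b1 := h.path₁ a s ha has (by linarith)
        have b2 := h.path₂ a s ha has (by linarith)
        have hp : (s - a) ^ κ ≤ 1 := Real.rpow_le_one (by linarith) (by linarith) (by linarith)
        have hp' := mul_le_of_le_one_right hC hp
        have e : x₁ s - x₂ s = (x₁ s - x₁ a) - (x₂ s - x₂ a) := by rw [hxa]; abel
        rw [e]
        refine (norm_sub_le _ _).trans ?_
        linarith
      · have hl : 0 ≤ t - s := by linarith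
        have hp : (t - s) ^ (3 * κ) ≤ (t - s) ^ (2 * κ) :=
          rpow_le_rpow_of_le_one hl (by linarith) (by linarith) (by linarith)
        refine (h.order s t (by linarith) hst (by linarith)).trans ?_
        have := Real.rpow_nonneg hl (2 * κ)
        exact mul_le_mul (by linarith) hp (Real.rpow_nonneg hl _) (by positivity)
    | succ n ih =>
      obtain ⟨ih1, ih2⟩ := ih
      set M := 2 * C * (1 / 2 : ℝ) ^ n with hM
      have hM0 : 0 ≤ M := by positivity
      have hMs : 2 * C * (1 / 2 : ℝ) ^ (n + 1) = M / 2 := by rw [hM, pow_succ]; ring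
      rw [hMs]
      refine ⟨fun s has hse => ?_, fun s t has hst hte => ?_⟩
      · have := (h.norm_incr_le hσ.toCoeffBound hR hκ hκ2 hB ha has (by linarith) (by linarith)
          (fun u hu hus => ih1 u hu (by linarith)) (ih2 a s le_rfl has hse)).1
        have e : x₁ s - x₂ s = (x₁ s - x₁ a) - (x₂ s - x₂ a) := by rw [hxa]; abel
        rw [e]
        refine this.trans ?_
        have hp := hsmall (s - a) (by linarith) (by linarith) κ (by linarith)
        calc N * M * (s - a) ^ κ ≤ N * M * c := mul_le_mul_of_nonneg_left hp (by positivity)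
          _ = (N * c) * M := by ring
          _ ≤ (1 / 2) * M := by
            refine mul_le_mul_of_nonneg_right (le_trans ?_ hcNA) hM0
            exact mul_le_mul_of_nonneg_right (by linarith) hc0.le
          _ = M / 2 := by ring
      · have hl : 0 ≤ t - s := by linarith
        -- The a priori order `3κ` only makes sewing applicable; the resulting constant comes from
        -- the defect and is proportional to `M`.
        have := norm_le_of_norm_delta_le (R := R) (a := a) (b := e) (θ := 2 / 3 + κ) (ν := 3 * κ)
          (by linarith) (by linarith)
          (fun s t has hst hte => h.order s t (by linarith) hst (by linarith))
          (fun s u t has hsu hut hte => h.norm_delta_le hσ hR hκ hκ2 hB (by linarith) hsu hut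
            (by linarith) (by linarith) (fun v hv hvu => ih1 v (by linarith) (by linarith))
            (ih2 s u has hsu (by linarith))) has hst hte
        refine this.trans ?_
        have e1 : (t - s) ^ (2 / 3 + κ) = (t - s) ^ (2 / 3 - κ) * (t - s) ^ (2 * κ) := by
          rw [← Real.rpow_add_of_nonneg hl (by linarith) (by linarith)]; ring_nf
        have hp := hsmall (t - s) hl (by linarith) (2 / 3 - κ) (by linarith)
        have hq := Real.rpow_nonneg hl (2 * κ)
        rw [mul_div_right_comm, ← hA, e1, ← mul_assoc]
        refine mul_le_mul_of_nonneg_right ?_ hq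
        calc A * M * (t - s) ^ (2 / 3 - κ) ≤ A * M * c :=
              mul_le_mul_of_nonneg_left hp (by positivity)
          _ = (A * c) * M := by ring
          _ ≤ (1 / 2) * M := by
            refine mul_le_mul_of_nonneg_right (le_trans ?_ hcNA) hM0
            exact mul_le_mul_of_nonneg_right (by linarith) hc0.le
          _ = M / 2 := by ring
  have hlim : Filter.Tendsto (fun n : ℕ => 2 * C * (1 / 2 : ℝ) ^ n) Filter.atTop (nhds 0) := by
    simpa using (tendsto_pow_atTop_nhds_zero_of_lt_one (by norm_num : (0 : ℝ) ≤ 1 / 2)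
      (by norm_num)).const_mul (2 * C)
  have := ge_of_tendsto' hlim fun n => (key n).1 e hae le_rfl
  exact sub_eq_zero.1 (norm_le_zero_iff.1 this)

lemma IsDifference.eqOn (h : IsDifference T κ B C σ ζ ζ2 x₁ x₂ V R)
    (hσ : CoeffBound₃ T K σ) (hR : RoughBound T κ Z ζ ζ2) (hκ : 1 / 3 < κ) (hκ2 : κ ≤ 1 / 2)
    (hB : 0 ≤ B) (h0 : x₁ 0 = x₂ 0) : EqOn x₁ x₂ (Icc 0 T) := by
  obtain ⟨η, hη, hstep⟩ := h.eq_of_eq hσ hR hκ hκ2 hB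
  have key : ∀ n : ℕ, ∀ t, 0 ≤ t → t ≤ T → t ≤ n * η → x₁ t = x₂ t := by
    intro n
    induction n with
    | zero =>
      intro t ht0 _ ht
      have : t = 0 := le_antisymm (by simpa using ht) ht0
      rw [this, h0]
    | succ n ih =>
      intro t ht0 htT ht
      push_cast at ht
      rcases le_total t (n * η) with hle | hle
      · exact ih t ht0 htT hle
      · have hn : 0 ≤ n * η := by positivity
        exact hstep (n * η) t hn hle htT (by linarith) (ih _ hn (hle.trans htT) le_rfl)
  intro t ht
  obtain ⟨n, hn⟩ := exists_nat_ge (t / η)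
  exact key n t ht.1 ht.2 ((div_le_iff₀ hη).1 hn)

end Uniqueness

/-! ### Uniqueness for solutions -/

section SolutionUniqueness

variable {d m : ℕ} {T α κ : ℝ} {ζ : ℝ → Euc d}
  {ζ2 : ℝ → ℝ → Fin d → Fin d → ℝ} {b : ℝ → Euc m → Euc m}
  {σ : ℝ → Euc m → Euc d →L[ℝ] Euc m} {y : Euc m} {x₁ x₂ : ℝ → Euc m}
  {x₁' x₂' : ℝ → Euc d →L[ℝ] Euc m}

lemma IsSolution.secondField_eq {x : ℝ → Euc m} {x' : ℝ → Euc d →L[ℝ] Euc m}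
    (h : IsSolution T κ ζ ζ2 b σ y x x') {s : ℝ} (hs : s ∈ Icc 0 T) :
    (fderiv ℝ (σ s) (x s)).comp (x' s) = secondField σ s (x s) := by
  rw [h.deriv_eq s hs]; rfl

/-- Subtracting the two integral identities produces an `IsDifference` with `R = g₁ - g₂`. Equality
of the derivatives then follows from `x' = σ(·, x)`. -/
lemma IsSolution.eqOn (hζ : IsGeometricRoughPath T α ζ ζ2) (hb : IsCb T 0 1 b)
    (hσ : IsCb T 1 3 σ) (hκ : 1 / 3 < κ) (hκα : κ < α) (hκ2 : κ ≤ 1 / 2)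
    (h₁ : IsSolution T κ ζ ζ2 b σ y x₁ x₁') (h₂ : IsSolution T κ ζ ζ2 b σ y x₂ x₂') :
    EqOn x₁ x₂ (Icc 0 T) ∧ EqOn x₁' x₂' (Icc 0 T) := by
  obtain ⟨K, hK⟩ := hσ.exists_coeffBound₃
  obtain ⟨Z, hZ⟩ := hζ.exists_roughBound (by linarith) hκα.le
  obtain ⟨B, hB0, hB⟩ := hb.exists_bound
  obtain ⟨_, g₁, hg₁, hJ₁⟩ := h₁.integral_eq
  obtain ⟨_, g₂, hg₂, hJ₂⟩ := h₂.integral_eq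
  obtain ⟨C₁, hC₁0, hC₁⟩ := Holder₂.exists_nonneg h₁.controlled.holder
  obtain ⟨C₂, hC₂0, hC₂⟩ := Holder₂.exists_nonneg h₂.controlled.holder
  obtain ⟨C₃, hC₃0, hC₃⟩ := h₁.controlled.holder_remainder.exists_nonneg
  obtain ⟨C₄, hC₄0, hC₄⟩ := hg₁.holder.exists_nonneg
  obtain ⟨C₅, hC₅0, hC₅⟩ := hg₂.holder.exists_nonneg
  have hκ0 : 0 < κ := by linarith
  have c₁ := Holder₁.continuousOn hκ0 h₁.controlled.holder
  have c₂ := Holder₁.continuousOn hκ0 h₂.controlled.holder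
  have hdiff : IsDifference T κ B (C₁ + C₂ + C₃ + C₄ + C₅) σ ζ ζ2 x₁ x₂
      (fun s t => (∫ u in s..t, b u (x₁ u)) - ∫ u in s..t, b u (x₂ u))
      (fun s t => g₁ s t - g₂ s t) := by
    have pow : ∀ s t p : ℝ, s ≤ t → 0 ≤ (t - s) ^ p := fun s t p hst =>
      Real.rpow_nonneg (sub_nonneg.2 hst) p
    refine ⟨by positivity, fun s t hs hst ht => ?_, fun s t hs hst ht => ?_,
      fun s t hs hst ht => ?_, fun s t M hs hst ht hM => ?_, fun s t hs hst ht => ?_,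
      fun s t hs hst ht => ?_, fun s u t hs hsu hut ht => ?_⟩
    · exact (hC₁ s t hs hst ht).trans (mul_le_mul_of_nonneg_right (by linarith) (pow _ _ _ hst))
    · exact (hC₂ s t hs hst ht).trans (mul_le_mul_of_nonneg_right (by linarith) (pow _ _ _ hst))
    · have := hC₃ s t hs hst ht
      rw [remainder, h₁.deriv_eq s ⟨hs, hst.trans ht⟩] at this
      exact this.trans (mul_le_mul_of_nonneg_right (by linarith) (pow _ _ _ hst))
    · rw [← intervalIntegral.integral_sub (intervalIntegrable_drift hb.continuousOn c₁ hs hst ht)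
        (intervalIntegrable_drift hb.continuousOn c₂ hs hst ht)]
      have := intervalIntegral.norm_integral_le_of_norm_le_const
        (f := fun u => b u (x₁ u) - b u (x₂ u)) (C := B * M) (a := s) (b := t) fun u hu => by
          rw [uIoc_of_le hst] at hu
          have uI : u ∈ Icc 0 T := ⟨by linarith [hu.1], by linarith [hu.2]⟩
          -- The bounded space derivative of `b` makes the drift difference linear in `M`.
          refine (norm_sub_le_of_norm_fderiv_le (hb.differentiable le_rfl uI) (C := B)
            (fun x => ?_) _ _).trans (mul_le_mul_of_nonneg_left (hM u hu.1.le hu.2) hB0)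
          rw [norm_fderiv_eq_iteratedFDeriv]
          exact hB 1 le_rfl u uI x
      rwa [abs_of_nonneg (by linarith)] at this
    · refine (norm_sub_le _ _).trans ((add_le_add (hC₄ s t hs hst ht) (hC₅ s t hs hst ht)).trans ?_)
      rw [← add_mul]
      exact mul_le_mul_of_nonneg_right (by linarith) (pow _ _ _ hst)
    · have sI : s ∈ Icc 0 T := ⟨hs, hst.trans ht⟩
      have e₁ := hJ₁ s t hs hst ht
      have e₂ := hJ₂ s t hs hst ht
      simp only [h₁.secondField_eq sI] at e₁
      simp only [h₂.secondField_eq sI] at e₂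
      have f₁ : x₁ t - x₁ s = _ := sub_eq_iff_eq_add.1 e₁
      have f₂ : x₂ t - x₂ s = _ := sub_eq_iff_eq_add.1 e₂
      rw [f₁, f₂, areaTerm_sub_left, sub_apply]
      abel
    · have sI : s ∈ Icc 0 T := ⟨hs, by linarith⟩
      have uI : u ∈ Icc 0 T := ⟨by linarith, by linarith⟩
      have e₁ := hg₁.delta_eq s u t hs hsu hut ht
      have e₂ := hg₂.delta_eq s u t hs hsu hut ht
      simp only [remainder, incr, h₁.secondField_eq sI, h₁.secondField_eq uI] at e₁
      simp only [remainder, incr, h₂.secondField_eq sI, h₂.secondField_eq uI] at e₂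
      have e : delta (fun s t => g₁ s t - g₂ s t) s u t = delta g₁ s u t - delta g₂ s u t := by
        simp only [delta]; abel
      rw [e, e₁, e₂]
      simp only [incr, sub_apply, areaTerm_sub_left]
      abel
  have heq := hdiff.eqOn hK hZ hκ hκ2 hB0 (h₁.initial.trans h₂.initial.symm)
  exact ⟨heq, fun t ht => by rw [h₁.deriv_eq t ht, h₂.deriv_eq t ht, heq ht]⟩

end SolutionUniqueness

end RoughDE

theorem mainTheorem4 {d m : ℕ} (T : ℝ) (hT : 0 < T) (α : ℝ) (hα : 1 / 3 < α)
    (ζ : ℝ → RoughDE.Euc d) (ζ2 : ℝ → ℝ → Fin d → Fin d → ℝ)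
    (hζ : RoughDE.IsGeometricRoughPath T α ζ ζ2)
    (b : ℝ → RoughDE.Euc m → RoughDE.Euc m) (hb : RoughDE.IsCb T 0 1 b)
    (σ : ℝ → RoughDE.Euc m → RoughDE.Euc d →L[ℝ] RoughDE.Euc m) (hσ : RoughDE.IsCb T 1 2 σ)
    (κ : ℝ) (hκ : 1 / 3 < κ) (hκα : κ < α) (hκ2 : κ ≤ 1 / 2) (y : RoughDE.Euc m) :
    (∃ (x : ℝ → RoughDE.Euc m) (x' : ℝ → RoughDE.Euc d →L[ℝ] RoughDE.Euc m),
      RoughDE.IsSolution T κ ζ ζ2 b σ y x x' ∧ RoughDE.Holder₁ T (min α 1) x) ∧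
    (RoughDE.IsCb T 1 3 σ →
      ∀ (x₁ x₂ : ℝ → RoughDE.Euc m) (x₁' x₂' : ℝ → RoughDE.Euc d →L[ℝ] RoughDE.Euc m),
        RoughDE.IsSolution T κ ζ ζ2 b σ y x₁ x₁' → RoughDE.IsSolution T κ ζ ζ2 b σ y x₂ x₂' →
          EqOn x₁ x₂ (Icc 0 T) ∧ EqOn x₁' x₂' (Icc 0 T)) :=
  ⟨RoughDE.exists_isSolution hT hζ hb hσ hκ hκα hκ2 y, fun hσ₃ _ _ _ _ h₁ h₂ =>
    h₁.eqOn hζ hb hσ₃ hκ hκα hκ2 h₂⟩
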